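/- Let $\lambda_0,\lambda_1>0$, $\gamma_0,\gamma_1>0$ and $a_0,a_1\in\mathbb R$, put $\rho_i=a_i/\gamma_i$ and $\alpha_i=\lambda_i/\gamma_i$, and assume $\rho_0<\rho_1$. Let $\varepsilon=(\varepsilon(t))_{t\ge0}$ be the continuous-time Markov chain on $\{0,1\}$ with transition intensities $\lambda_0$ (for $0\to1$) and $\lambda_1$ (for $1\to0$), and let $X$ be the Kac–Ornstein–Uhlenbeck process $$X(t)=x\,e^{-\Gamma(t)}+\int_0^t a_{\varepsilon(s)}e^{-(\Gamma(t)-\Gamma(s))}\,ds,\qquad \Gamma(t)=\int_0^t\gamma_{\varepsilon(s)}\,ds,$$ that is, the solution of $X(t)=x+\int_0^t(a_{\varepsilon(s)}-\gamma_{\varepsilon(s)}X(s))\,ds$. Let $\mathcal P(t,\cdot\mid x,i)$ be the law of $\langle X(t),\varepsilon(t)\rangle$ given $X(0)=x$, $\varepsilon(0)=i$. A probability measure $\mu$ on $\mathbb R\times\{0,1\}$ is called invariant if $\mu(B)=\int\mathcal P(t,B\mid z)\,\mu(dz)$ for all $t\ge0$ and all Borel sets $B$. Then the Markov process $\langle X,\varepsilon\rangle$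 has exactly one invariant probability measure $\mu$. It is supported on $[\rho_0,\rho_1]\times\{0,1\}$, and $\mu(B\times\{i\})=\int_B\pi_i(x)\,dx$ for $i=0,1$ and all Borel $B\subset\mathbb R$, where $$\pi_0(x)=c\,\gamma_0^{-1}(x-\rho_0)^{\alpha_0-1}(\rho_1-x)^{\alpha_1}\mathbf 1_{\{\rho_0<x<\rho_1\}},\qquad \pi_1(x)=c\,\gamma_1^{-1}(x-\rho_0)^{\alpha_0}(\rho_1-x)^{\alpha_1-1}\mathbf 1_{\{\rho_0<x<\rho_1\}},$$ and the normalising constant $c>0$, for which $\int_{\rho_0}^{\rho_1}(\pi_0(x)+\pi_1(x))\,dx=1$, is given by $$c^{-1}=(\rho_1-\rho_0)^{\alpha_0+\alpha_1}\left[\gamma_0^{-1}B(\alpha_0,\alpha_1+1)+\gamma_1^{-1}B(\alpha_0+1,\alpha_1)\right],$$ with $B(\cdot,\cdot)$ Euler's beta function. In particular, if $\lambda_0=\lambda_1=\gamma_0=\gamma_1=\gamma$, then $c^{-1}=(\rho_1-\rho_0)^2\gamma^{-1}$, and for $\rho_0<x<\rho_1$ the densities are the linear functions $\pi_0(x)=(\rho_1-\rho_0)^{-2}(\rho_1-x)$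 and $\pi_1(x)=(\rho_1-\rho_0)^{-2}(x-\rho_0)$; the $X$-marginal of $\mu$ is then the uniform distribution on $[\rho_0,\rho_1]$. -/

import Mathlib

open MeasureTheory ProbabilityTheory Set

namespace KacOU

noncomputable section

/-- The state occupied by a two-state chain after `n` switches, when it starts in state `i`. -/
def visited (i : Fin 2) (n : ℕ) : Fin 2 := (fun j => 1 - j)^[n] i

/-- The joint law of the successive holding times of the two-state continuous-time Markov chain
with transition intensities `lam 0` (for `0 → 1`) and `lam 1` (for `1 → 0`), started in state `i`:
the holding times are independent, and a holding time spent in state `j` is exponentially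
distributed with rate `lam j`. -/
def holdingLaw (lam : Fin 2 → ℝ) (i : Fin 2) : Measure (ℕ → ℝ) :=
  Measure.infinitePi fun k => expMeasure (lam (visited i k))

/-- The time of the `n`-th switch, as a function of the sequence of holding times. -/
def switchTime (τ : ℕ → ℝ) (n : ℕ) : ℝ := ∑ k ∈ Finset.range n, τ k

/-- The number of switches up to and including time `t`. -/
def switchCount (τ : ℕ → ℝ) (t : ℝ) : ℕ := {n : ℕ | switchTime τ (n + 1) ≤ t}.ncard

/-- The (right-continuous) path of the chain that starts in `i` and has holding times `τ`. -/
def chain (i : Fin 2) (τ : ℕ → ℝ) (t : ℝ) : Fin 2 := visited i (switchCount τ t)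

/-- `Γ(t) = ∫₀ᵗ γ_{ε(s)} ds` along the path `e` of the chain. -/
def Gam (γ : Fin 2 → ℝ) (e : ℝ → Fin 2) (t : ℝ) : ℝ := ∫ s in (0 : ℝ)..t, γ (e s)

/-- The Kac-Ornstein-Uhlenbeck process driven by the path `e` of the chain and started at `x`:
`X(t) = x exp(-Γ(t)) + ∫₀ᵗ a_{ε(s)} exp(-(Γ(t) - Γ(s))) ds`, the solution of
`X(t) = x + ∫₀ᵗ (a_{ε(s)} - γ_{ε(s)} X(s)) ds`. -/
def position (a γ : Fin 2 → ℝ) (e : ℝ → Fin 2) (x t : ℝ) : ℝ :=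
  x * Real.exp (-Gam γ e t)
    + ∫ s in (0 : ℝ)..t, a (e s) * Real.exp (-(Gam γ e t - Gam γ e s))

/-- The transition function of the Markov process `Ξ(t) = (X(t), ε(t))` on `ℝ × {0, 1}`: the law
of `Ξ(t)` given `Ξ(0) = z = (x, i)`. -/
def transition (lam a γ : Fin 2 → ℝ) (t : ℝ) (z : ℝ × Fin 2) : Measure (ℝ × Fin 2) :=
  (holdingLaw lam z.2).map fun τ =>
    (position a γ (chain z.2 τ) z.1 t, chain z.2 τ t)

/-- A measure `μ` on `ℝ × {0, 1}` is invariant for `Ξ` if it is a fixed point of the adjoint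
semigroup: `μ(B) = ∫ P(t, B | z) μ(dz)` for all `t ≥ 0`. -/
def IsInvariant (lam a γ : Fin 2 → ℝ) (μ : Measure (ℝ × Fin 2)) : Prop :=
  ∀ t : ℝ, 0 ≤ t → ∀ B : Set (ℝ × Fin 2), MeasurableSet B →
    μ B = ∫⁻ z, transition lam a γ t z B ∂μ

/-- The measure `μ` on `ℝ × {0, 1}` has the pair of (nonnegative) densities `(p 0, p 1)`:
`μ(B × {i}) = ∫_B p i x dx`. -/
def HasDensities (μ : Measure (ℝ × Fin 2)) (p : Fin 2 → ℝ → ℝ) : Prop :=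
  ∀ i : Fin 2, Measurable (p i) ∧ (∀ x, 0 ≤ p i x) ∧
    ∀ B : Set ℝ, MeasurableSet B → μ (B ×ˢ {i}) = ∫⁻ x in B, ENNReal.ofReal (p i x)

end

end KacOU

/-! Existence. Let `G i (t, x)` be the probability of being in `B` at time `t` after a start at `(x,
i)`. Conditioning on the first switch gives a renewal equation for `G` (`transition_renewal`). In
the unit coordinate measured from `ρ i` towards `ρ (1 - i)`, the flow of state `i` is multiplication
by `exp (-γ i * s)`, and the beta-shaped densities satisfy a mirror equation: what sits in state `i`
either has been there for the whole time `t`, or entered it from `1 - i` at a last switch a time `s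
< t` ago (`lintegral_density_balance`). This reduces to the fundamental theorem of calculus along a
backward trajectory (`profile_balance`).

Expanding pairings of densities with `G` by whichever equation applies (`lintegral_add_flux`), one
finds for each `i` that the mass carried into `B` from starts in `i`, plus a flux term `E (1 - i)`,
equals the mass of `B` in state `i` plus `E i`. Summed over `i`, the finite fluxes cancel and
invariance remains. Neither the semigroup property nor the generator is used.

Uniqueness. Two paths driven by the same holding times approach each other like `exp (-Γ(t))`, so
the starting position is forgotten uniformly over the chain's paths. Hence an invariant law is
determined by its marginal on the states (`integral_eq_of_isInvariant`), and that marginal is forced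
by stationarity of the two-state chain at time 1 (`map_snd_eq_of_isInvariant`). Characteristic
functions on the two slices then separate measures. -/

namespace KacOU

/-! ### Holding times: splitting off the first one, and absence of explosion. -/

/-- The sequence with first term `z.1` followed by the terms of `z.2`. -/
def cons (z : ℝ × (ℕ → ℝ)) : ℕ → ℝ
  | 0 => z.1
  | k + 1 => z.2 k

@[simp] lemma cons_zero (z : ℝ × (ℕ → ℝ)) : cons z 0 = z.1 := rfl

@[simp] lemma cons_succ (z : ℝ × (ℕ → ℝ)) (k : ℕ) : cons z (k + 1) = z.2 k := rfl

lemma measurable_cons : Measurable cons := by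
  refine measurable_pi_lambda _ fun n => ?_
  cases n with
  | zero => exact measurable_fst
  | succ k => exact (measurable_pi_apply k).comp measurable_snd

/-- A product measure on sequences is the law of a first term followed by an independent tail. -/
lemma map_cons_prod (μ : ℕ → Measure ℝ) [∀ k, IsProbabilityMeasure (μ k)] :
    ((μ 0).prod (Measure.infinitePi fun k => μ (k + 1))).map cons = Measure.infinitePi μ := by
  refine Measure.eq_infinitePi μ fun s t ht => ?_
  classical
  -- A cylinder over `s` is padded with `univ` to a box over `0, …, N`; this always includes
  -- coordinate 0, so the box splits into head and tail.
  obtain ⟨N, hN⟩ : ∃ N, s ⊆ Finset.range (N + 1) :=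
    ⟨s.sup id, fun n hn => Finset.mem_range_succ_iff.2 (Finset.le_sup (f := id) hn)⟩
  set t' : ℕ → Set ℝ := fun n => if n ∈ s then t n else univ with ht'
  have ht'm : ∀ n, MeasurableSet (t' n) := fun n => by
    simp only [ht']; split_ifs
    exacts [ht n, MeasurableSet.univ]
  have hpre : cons ⁻¹' (Set.pi s t)
      = t' 0 ×ˢ Set.pi (Finset.range N) (fun k => t' (k + 1)) := by
    ext z
    simp only [mem_preimage, Set.mem_pi, Finset.mem_coe, mem_prod, Finset.mem_range, ht']
    constructor
    · intro h
      refine ⟨?_, fun k _ => ?_⟩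
      · split_ifs with h0
        exacts [h 0 h0, trivial]
      · split_ifs with h0
        exacts [h (k + 1) h0, trivial]
    · rintro ⟨h0, h1⟩ n hn
      cases n with
      | zero => simpa [hn] using h0
      | succ k =>
        have := h1 k (by have := Finset.mem_range.1 (hN hn); omega)
        simpa [hn] using this
  rw [Measure.map_apply measurable_cons (.pi s.countable_toSet fun _ _ => ht _), hpre,
    Measure.prod_prod, Measure.infinitePi_pi _ (fun _ _ => ht'm _)]
  have h2 := Finset.prod_range_succ' (fun n => μ n (t' n)) N
  rw [mul_comm, ← h2, ← Finset.prod_subset hN]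
  · refine Finset.prod_congr rfl fun n hn => ?_
    simp [ht', hn]
  · intro n _ hn
    simp [ht', hn]

lemma visited_succ (i : Fin 2) (n : ℕ) : visited i (n + 1) = visited (1 - i) n := rfl

lemma expMeasure_Iic {r : ℝ} (hr : 0 < r) (x : ℝ) :
    expMeasure r (Iic x) = ENNReal.ofReal (if 0 ≤ x then 1 - Real.exp (-(r * x)) else 0) := by
  have := isProbabilityMeasure_expMeasure hr
  rw [← cdf_expMeasure_eq hr, ofReal_cdf]

section Law

variable {lam : Fin 2 → ℝ} (hlam : ∀ i, 0 < lam i)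
include hlam

lemma isProbabilityMeasure_holdingLaw (i : Fin 2) : IsProbabilityMeasure (holdingLaw lam i) := by
  have : ∀ k, IsProbabilityMeasure (expMeasure (lam (visited i k))) :=
    fun k => isProbabilityMeasure_expMeasure (hlam _)
  unfold holdingLaw
  infer_instance

lemma holdingLaw_eq_map_cons (i : Fin 2) :
    holdingLaw lam i
      = ((expMeasure (lam i)).prod (holdingLaw lam (1 - i))).map cons := by
  have : ∀ k, IsProbabilityMeasure (expMeasure (lam (visited i k))) :=
    fun k => isProbabilityMeasure_expMeasure (hlam _)
  exact (map_cons_prod fun k => expMeasure (lam (visited i k))).symm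

/-- The sequences of nonnegative holding times that add up to infinity. -/
def nonexplosive : Set (ℕ → ℝ) :=
  {τ | (∀ k, 0 ≤ τ k) ∧ ∀ m, ∃ k, m ≤ k ∧ 1 ≤ τ k}

lemma ae_nonexplosive (i : Fin 2) : ∀ᵐ τ ∂(holdingLaw lam i), τ ∈ nonexplosive := by
  have hp : ∀ k, IsProbabilityMeasure (expMeasure (lam (visited i k))) :=
    fun k => isProbabilityMeasure_expMeasure (hlam _)
  refine Filter.Eventually.and (ae_all_iff.2 fun k => ?_) (ae_all_iff.2 fun m => ?_)
  · have h1 : expMeasure (lam (visited i k)) (Iic 0) = 0 := by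
      rw [expMeasure_Iic (hlam _)]; simp
    have h2 := (measurePreserving_eval_infinitePi
      (fun k => expMeasure (lam (visited i k))) k).measure_preimage
      (measurableSet_Iic (a := (0 : ℝ))).nullMeasurableSet
    rw [h1] at h2
    refine measure_mono_null (fun τ hτ => ?_) h2
    simp only [mem_compl_iff, mem_ofPred_eq, not_le] at hτ
    exact hτ.le
  · obtain ⟨r, hr, hrl⟩ : ∃ r : ℝ, 0 < r ∧ ∀ j, lam j ≤ r :=
      ⟨lam 0 + lam 1, add_pos (hlam 0) (hlam 1), fun j => by
        fin_cases j
        · simpa using (hlam 1).le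
        · simpa using (hlam 0).le⟩
    -- `q` bounds the probability that a holding time is at most 1, in either state; by independence
    -- `n` consecutive such holding times have probability at most `q ^ n`.
    set q : ENNReal := ENNReal.ofReal (1 - Real.exp (-r)) with hq
    have hq1 : q < 1 := by
      rw [hq, ← ENNReal.ofReal_one]
      exact ENNReal.ofReal_lt_ofReal_iff one_pos |>.2 (by have := Real.exp_pos (-r); linarith)
    refine le_antisymm (ge_of_tendsto' (ENNReal.tendsto_pow_atTop_nhds_zero_of_lt_one hq1)
      fun n => ?_) zero_le
    calc (holdingLaw lam i) {τ | ∃ k, m ≤ k ∧ 1 ≤ τ k}ᶜ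
        ≤ (holdingLaw lam i) (Set.pi (Finset.Ico m (m + n)) fun _ => Iic 1) := by
          refine measure_mono fun τ hτ k hk => ?_
          simp only [mem_compl_iff, mem_ofPred_eq, not_exists, not_and, not_le] at hτ
          exact (hτ k (Finset.mem_Ico.1 hk).1).le
      _ = ∏ k ∈ Finset.Ico m (m + n), expMeasure (lam (visited i k)) (Iic 1) :=
          Measure.infinitePi_pi _ fun _ _ => measurableSet_Iic
      _ ≤ ∏ k ∈ Finset.Ico m (m + n), q := by
          refine Finset.prod_le_prod' fun k _ => ?_
          rw [expMeasure_Iic (hlam _), if_pos zero_le_one]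
          refine ENNReal.ofReal_le_ofReal ?_
          have := Real.exp_le_exp.2 (neg_le_neg (hrl (visited i k)))
          rw [mul_one]
          linarith
      _ = q ^ n := by simp

end Law

/-! ### Paths of the chain before and after the first switch. -/

section Path

/-- Infinitely many holding times are at least 1, so the switch times are unbounded. Finiteness
matters because `ncard` of an infinite set is 0, which would spoil counting one extra switch. -/
lemma finite_switchTime_le {τ : ℕ → ℝ} (hτ : τ ∈ nonexplosive) (t : ℝ) :
    {n : ℕ | switchTime τ (n + 1) ≤ t}.Finite := by
  have hmono : Monotone (switchTime τ) := monotone_nat_of_le_succ fun n => by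
    simp only [switchTime, Finset.sum_range_succ]; linarith [hτ.1 n]
  have hlarge : ∀ N : ℕ, ∃ m, (N : ℝ) ≤ switchTime τ m := by
    intro N
    induction N with
    | zero => exact ⟨0, by simp [switchTime]⟩
    | succ N ih =>
      obtain ⟨m, hm⟩ := ih
      obtain ⟨k, hk, h1⟩ := hτ.2 m
      refine ⟨k + 1, ?_⟩
      have := hmono hk
      have h2 : switchTime τ (k + 1) = switchTime τ k + τ k := Finset.sum_range_succ _ _
      push_cast; linarith
  obtain ⟨N, hN⟩ := exists_nat_gt t
  obtain ⟨m, hm⟩ := hlarge N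
  refine (Set.finite_lt_nat m).subset fun n hn => ?_
  by_contra hnm
  have := hmono (show m ≤ n + 1 by simp only [mem_ofPred_eq] at hnm; omega)
  simp only [mem_ofPred_eq] at hn
  linarith

lemma switchTime_cons_succ (z : ℝ × (ℕ → ℝ)) (n : ℕ) :
    switchTime (cons z) (n + 1) = z.1 + switchTime z.2 n := by
  simp only [switchTime, Finset.sum_range_succ', cons_succ, cons_zero]
  ring

lemma switchTime_nonneg {τ : ℕ → ℝ} (hτ : τ ∈ nonexplosive) (n : ℕ) : 0 ≤ switchTime τ n :=
  Finset.sum_nonneg fun k _ => hτ.1 k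

lemma chain_cons_of_lt (i : Fin 2) {s u : ℝ} {τ : ℕ → ℝ} (hτ : τ ∈ nonexplosive) (hu : u < s) :
    chain i (cons (s, τ)) u = i := by
  have : {n : ℕ | switchTime (cons (s, τ)) (n + 1) ≤ u} = ∅ := by
    ext n
    simp only [switchTime_cons_succ, mem_ofPred_eq, mem_empty_iff_false, iff_false, not_le]
    have := switchTime_nonneg hτ n
    linarith
  simp [chain, switchCount, this, visited]

lemma chain_cons_of_le (i : Fin 2) {s u : ℝ} {τ : ℕ → ℝ} (hτ : τ ∈ nonexplosive) (hu : s ≤ u) :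
    chain i (cons (s, τ)) u = chain (1 - i) τ (u - s) := by
  have : {n : ℕ | switchTime (cons (s, τ)) (n + 1) ≤ u}
      = insert 0 (Nat.succ '' {n : ℕ | switchTime τ (n + 1) ≤ u - s}) := by
    ext n
    simp only [switchTime_cons_succ, mem_ofPred_eq, mem_insert_iff, mem_image]
    cases n with
    | zero => simpa [switchTime] using hu
    | succ k =>
      simp only [Nat.add_eq_zero_iff, one_ne_zero, and_false, false_or, Nat.succ_eq_add_one,
        Nat.add_right_cancel_iff, exists_eq_right]
      constructor <;> intro h <;> linarith
  have hc : switchCount (cons (s, τ)) u = switchCount τ (u - s) + 1 := by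
    rw [switchCount, this, ncard_insert_of_notMem (by simp)
      ((finite_switchTime_le hτ _).image _), ncard_image_of_injective _ Nat.succ_injective,
      switchCount]
  rw [chain, hc, visited_succ, chain]

end Path

/-! ### Joint measurability in time, starting point and holding times. -/

section Measurability

lemma measurable_switchTime (n : ℕ) : Measurable fun τ : ℕ → ℝ => switchTime τ n := by
  unfold switchTime
  exact Finset.measurable_sum _ fun k _ => measurable_pi_apply k

lemma measurable_switchCount : Measurable fun z : (ℕ → ℝ) × ℝ => switchCount z.1 z.2 := by
  -- The identity also holds on explosive sequences: there `ncard` is 0 and so is `toReal` of an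
  -- infinite sum.
  have h : ∀ z : (ℕ → ℝ) × ℝ, (switchCount z.1 z.2 : ℝ)
      = (∑' n : ℕ, {w : (ℕ → ℝ) × ℝ | switchTime w.1 (n + 1) ≤ w.2}.indicator
          (fun _ => (1 : ENNReal)) z).toReal := by
    intro z
    set S : Set ℕ := {n | switchTime z.1 (n + 1) ≤ z.2} with hS
    have h1 : (∑' n : ℕ, {w : (ℕ → ℝ) × ℝ | switchTime w.1 (n + 1) ≤ w.2}.indicator
        (fun _ => (1 : ENNReal)) z) = Measure.count S := by
      rw [Measure.count_apply S.to_countable.measurableSet, ← ENNReal.tsum_set_one,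
        tsum_subtype S fun _ => (1 : ENNReal)]
      rfl
    rw [h1, switchCount]
    by_cases hf : S.Finite
    · rw [Measure.count_apply_finite _ hf, ← hS, Set.ncard_eq_toFinset_card _ hf]; simp
    · rw [Measure.count_apply_infinite hf, ← hS, Set.Infinite.ncard hf]; simp
  have hm : Measurable fun z : (ℕ → ℝ) × ℝ => (switchCount z.1 z.2 : ℝ) := by
    simp_rw [h]
    refine Measurable.ennreal_toReal (Measurable.tsum fun n => ?_)
    exact measurable_const.indicator
      (measurableSet_le ((measurable_switchTime _).comp measurable_fst) measurable_snd)
  refine measurable_to_countable' fun n => ?_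
  have := hm (measurableSet_singleton (n : ℝ))
  convert this using 1
  ext z; simp

lemma measurable_chain {Ω : Type*} [MeasurableSpace Ω] (i : Fin 2) {τ : Ω → ℕ → ℝ} {t : Ω → ℝ}
    (hτ : Measurable τ) (ht : Measurable t) : Measurable fun w => chain i (τ w) (t w) := by
  have h : Measurable (visited i) := measurable_from_nat
  have h2 := h.comp (measurable_switchCount.comp (hτ.prodMk ht))
  rw [Function.comp_def, Function.comp_def] at h2
  exact h2

/-- With the variable endpoint moved into an indicator on the product space, measurability of
integrals with a parameter applies. -/
lemma measurable_intervalIntegral {Ω : Type*} [MeasurableSpace Ω] {f : Ω × ℝ → ℝ}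
    (hf : Measurable f) {b : Ω → ℝ} (hb : Measurable b) :
    Measurable fun w => ∫ s in (0 : ℝ)..b w, f (w, s) := by
  have key : ∀ {l u : Ω → ℝ}, Measurable l → Measurable u →
      Measurable fun w => ∫ s in Ioc (l w) (u w), f (w, s) := by
    intro l u hl hu
    have hS : MeasurableSet {z : Ω × ℝ | z.2 ∈ Ioc (l z.1) (u z.1)} :=
      (measurableSet_lt (hl.comp measurable_fst) measurable_snd).inter
        (measurableSet_le measurable_snd (hu.comp measurable_fst))
    have h2 := ((hf.indicator hS).stronglyMeasurable.integral_prod_right'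
      (ν := (volume : Measure ℝ))).measurable
    convert h2 using 2 with w
    rw [← integral_indicator measurableSet_Ioc]
    rfl
  exact (key measurable_const hb).sub (key hb measurable_const)

variable (a γ : Fin 2 → ℝ) (i : Fin 2)

lemma measurable_Gam {Ω : Type*} [MeasurableSpace Ω] {τ : Ω → ℕ → ℝ} {t : Ω → ℝ}
    (hτ : Measurable τ) (ht : Measurable t) : Measurable fun w => Gam γ (chain i (τ w)) (t w) := by
  have h : Measurable fun w : Ω × ℝ => γ (chain i (τ w.1) w.2) :=
    (measurable_of_finite γ).comp (measurable_chain i (hτ.comp measurable_fst) measurable_snd)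
  exact measurable_intervalIntegral h ht

lemma measurable_position {Ω : Type*} [MeasurableSpace Ω] {τ : Ω → ℕ → ℝ} {x t : Ω → ℝ}
    (hτ : Measurable τ) (hx : Measurable x) (ht : Measurable t) :
    Measurable fun w => position a γ (chain i (τ w)) (x w) (t w) := by
  have hG : Measurable fun w => Gam γ (chain i (τ w)) (t w) := measurable_Gam γ i hτ ht
  have h1 : Measurable fun w : Ω × ℝ => a (chain i (τ w.1) w.2) :=
    (measurable_of_finite a).comp (measurable_chain i (hτ.comp measurable_fst) measurable_snd)
  have h2 : Measurable fun w : Ω × ℝ => Gam γ (chain i (τ w.1)) w.2 :=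
    measurable_Gam γ i (hτ.comp measurable_fst) measurable_snd
  have h3 : Measurable fun w : Ω × ℝ => Gam γ (chain i (τ w.1)) (t w.1) := hG.comp measurable_fst
  exact (hx.mul hG.neg.exp).add
    (measurable_intervalIntegral (h1.mul (h3.sub h2).neg.exp) ht)

/-- The state at time `z.1.1` of the process started in `(z.1.2, i)`, when the holding times are
`z.2`. -/
noncomputable def state (z : (ℝ × ℝ) × (ℕ → ℝ)) : ℝ × Fin 2 :=
  (position a γ (chain i z.2) z.1.2 z.1.1, chain i z.2 z.1.1)

lemma measurable_state : Measurable (state a γ i) :=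
  (measurable_position a γ i measurable_snd (measurable_snd.comp measurable_fst)
    (measurable_fst.comp measurable_fst)).prodMk
    (measurable_chain i measurable_snd (measurable_fst.comp measurable_fst))

lemma transition_eq_map (lam : Fin 2 → ℝ) (t x : ℝ) :
    transition lam a γ t (x, i) = (holdingLaw lam i).map fun τ => state a γ i ((t, x), τ) := rfl

lemma transition_apply (lam : Fin 2 → ℝ) (t x : ℝ) {B : Set (ℝ × Fin 2)} (hB : MeasurableSet B) :
    transition lam a γ t (x, i) B = holdingLaw lam i (Prod.mk (t, x) ⁻¹' (state a γ i ⁻¹' B)) := by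
  rw [transition_eq_map, Measure.map_apply ?_ hB]
  · rfl
  · exact (measurable_state a γ i).comp measurable_prodMk_left

lemma measurable_transition {lam : Fin 2 → ℝ} (hlam : ∀ i, 0 < lam i)
    {B : Set (ℝ × Fin 2)} (hB : MeasurableSet B) :
    Measurable fun z : ℝ × ℝ => transition lam a γ z.1 (z.2, i) B := by
  have := isProbabilityMeasure_holdingLaw hlam i
  simp_rw [transition_apply a γ i lam _ _ hB]
  exact measurable_measure_prodMk_left (measurable_state a γ i hB)

end Measurability

/-! ### The position along a path and its flow property. -/

/-- The position at time `s` of the process started at `x` while it remains in state `i`. -/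
noncomputable def flow (a γ : Fin 2 → ℝ) (i : Fin 2) (s x : ℝ) : ℝ :=
  a i / γ i + (x - a i / γ i) * Real.exp (-(γ i * s))

lemma measurable_flow (a γ : Fin 2 → ℝ) (i : Fin 2) :
    Measurable fun z : ℝ × ℝ => flow a γ i z.1 z.2 := by
  unfold flow; fun_prop

/-- The endpoint `u` is left out because a right-continuous path may already have switched there. -/
lemma integral_congr_of_forall_lt {f g : ℝ → ℝ} {u : ℝ} (hu : 0 ≤ u)
    (h : ∀ v, 0 ≤ v → v < u → f v = g v) : ∫ v in (0 : ℝ)..u, f v = ∫ v in (0 : ℝ)..u, g v := by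
  refine intervalIntegral.integral_congr_ae ?_
  have : ∀ᵐ v : ℝ, v ≠ u := by simp [ae_iff, measure_singleton]
  filter_upwards [this] with v hv hm
  rw [uIoc_of_le hu] at hm
  exact h v hm.1.le (lt_of_le_of_ne hm.2 hv)

lemma integral_mul_exp_sub (a c : ℝ) {g : ℝ} (hg : g ≠ 0) (t : ℝ) :
    ∫ v in (0 : ℝ)..t, a * Real.exp (-(c - g * v))
      = a / g * (Real.exp (-(c - g * t)) - Real.exp (-c)) := by
  have hd : ∀ v ∈ uIcc 0 t, HasDerivAt (fun v => a / g * Real.exp (-(c - g * v)))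
      (a * Real.exp (-(c - g * v))) v := by
    intro v _
    have h1 : HasDerivAt (fun v : ℝ => -(c - g * v)) g v := by
      have := ((hasDerivAt_id v).const_mul g).sub_const c
      simpa only [id_eq, mul_one, neg_sub] using this
    have := h1.exp.const_mul (a / g)
    convert! this using 1
    field_simp
  rw [intervalIntegral.integral_eq_sub_of_hasDerivAt hd
    (Continuous.intervalIntegrable (by fun_prop) _ _)]
  simp [mul_sub]

lemma measurable_chain_right (i : Fin 2) (τ : ℕ → ℝ) : Measurable (chain i τ) :=
  measurable_chain i measurable_const measurable_id

lemma intervalIntegrable_comp {e : ℝ → Fin 2} (he : Measurable e) (f : Fin 2 → ℝ) (u v : ℝ) :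
    IntervalIntegrable (fun s => f (e s)) volume u v := by
  have hm : Measurable fun s => f (e s) := (measurable_of_finite f).comp he
  refine (intervalIntegrable_const (c := |f 0| + |f 1|)).mono_fun hm.aestronglyMeasurable ?_
  refine Filter.Eventually.of_forall fun s => ?_
  simp only [Real.norm_eq_abs]
  rw [abs_of_nonneg (by positivity : 0 ≤ |f 0| + |f 1|)]
  rcases Fin.exists_fin_two.1 ⟨e s, rfl⟩ with h | h <;> rw [← h] <;> simp

lemma continuous_Gam (γ : Fin 2 → ℝ) {e : ℝ → Fin 2} (he : Measurable e) :
    Continuous (Gam γ e) :=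
  intervalIntegral.continuous_primitive (fun u v => intervalIntegrable_comp he γ u v) 0

lemma Gam_eq_of_forall_lt {γ : Fin 2 → ℝ} {e : ℝ → Fin 2} {i : Fin 2} {u : ℝ} (hu : 0 ≤ u)
    (h : ∀ v, v < u → e v = i) : Gam γ e u = γ i * u := by
  rw [Gam, integral_congr_of_forall_lt (g := fun _ => γ i) hu fun v _ hv => by rw [h v hv]]
  simp [mul_comm]

lemma position_eq_flow {a γ : Fin 2 → ℝ} (hγ : ∀ i, 0 < γ i) {e : ℝ → Fin 2} {i : Fin 2} {t : ℝ}
    (ht : 0 ≤ t) (h : ∀ v, v < t → e v = i) (x : ℝ) : position a γ e x t = flow a γ i t x := by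
  rw [position, Gam_eq_of_forall_lt ht h, integral_congr_of_forall_lt
    (g := fun v => a i * Real.exp (-(γ i * t - γ i * v))) ht, integral_mul_exp_sub _ _ (hγ i).ne', flow]
  · simp only [sub_self, neg_zero, Real.exp_zero]; ring
  · intro v hv hvt
    rw [h v hvt, Gam_eq_of_forall_lt hv fun w hw => h w (hw.trans hvt)]

/-- The flow property of the position at a time `s` before which the path is constant. -/
lemma position_eq_position_flow {a γ : Fin 2 → ℝ} (hγ : ∀ i, 0 < γ i) {e e' : ℝ → Fin 2}
    (he : Measurable e) {i : Fin 2} {s t : ℝ} (hs : 0 ≤ s) (hst : s ≤ t) (h : ∀ v, v < s → e v = i)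
    (h' : ∀ v, s ≤ v → e v = e' (v - s)) (x : ℝ) :
    position a γ e x t = position a γ e' (flow a γ i s x) (t - s) := by
  have hG : ∀ u, s ≤ u → Gam γ e u = γ i * s + Gam γ e' (u - s) := by
    intro u hu
    rw [Gam, ← intervalIntegral.integral_add_adjacent_intervals
      (intervalIntegrable_comp he γ 0 s) (intervalIntegrable_comp he γ s u)]
    congr 1
    · exact Gam_eq_of_forall_lt hs h
    · rw [Gam, ← sub_self s, ← intervalIntegral.integral_comp_sub_right]
      refine intervalIntegral.integral_congr fun v hv => ?_
      rw [uIcc_of_le hu] at hv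
      simp only [h' v hv.1]
  have hcont := continuous_Gam γ he
  have hint : ∀ u v, IntervalIntegrable
      (fun w => a (e w) * Real.exp (-(Gam γ e t - Gam γ e w))) volume u v := fun u v =>
    (intervalIntegrable_comp he a u v).mul_continuousOn (by fun_prop)
  have hint1 : ∫ v in (0 : ℝ)..s, a (e v) * Real.exp (-(Gam γ e t - Gam γ e v))
      = ∫ v in (0 : ℝ)..s, a i * Real.exp (-(Gam γ e t - γ i * v)) :=
    integral_congr_of_forall_lt hs fun v hv hvs => by
      rw [h v hvs, Gam_eq_of_forall_lt hv fun w hw => h w (hw.trans hvs)]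
  have hint2 : ∫ v in s..t, a (e v) * Real.exp (-(Gam γ e t - Gam γ e v))
      = ∫ v in (0 : ℝ)..(t - s), a (e' v) * Real.exp (-(Gam γ e' (t - s) - Gam γ e' v)) := by
    rw [← sub_self s, ← intervalIntegral.integral_comp_sub_right
      (fun v => a (e' v) * Real.exp (-(Gam γ e' (t - s) - Gam γ e' v)))]
    refine intervalIntegral.integral_congr fun v hv => ?_
    rw [uIcc_of_le hst] at hv
    simp only [h' v hv.1, hG t hst, hG v hv.1]
    congr 2; ring
  rw [position, ← intervalIntegral.integral_add_adjacent_intervals (hint 0 s) (hint s t), hint1,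
    hint2, integral_mul_exp_sub _ _ (hγ i).ne', position, hG t hst, flow]
  have e1 : Real.exp (-(γ i * s + Gam γ e' (t - s)))
      = Real.exp (-(γ i * s)) * Real.exp (-Gam γ e' (t - s)) := by rw [← Real.exp_add]; congr 1; ring
  have e2 : -(γ i * s + Gam γ e' (t - s) - γ i * s) = -Gam γ e' (t - s) := by ring
  rw [e1, e2]
  ring

/-! ### Renewal equation at the first switch. -/

section Renewal

variable {lam a γ : Fin 2 → ℝ}

lemma state_cons_of_lt (hγ : ∀ i, 0 < γ i) (i : Fin 2) {s t : ℝ} (ht : 0 ≤ t) (hst : t < s) (x : ℝ)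
    {τ : ℕ → ℝ} (hτ : τ ∈ nonexplosive) :
    state a γ i ((t, x), cons (s, τ)) = (flow a γ i t x, i) := by
  rw [state, chain_cons_of_lt i hτ hst, position_eq_flow hγ ht fun v hv =>
    chain_cons_of_lt i hτ (hv.trans hst)]

lemma state_cons_of_le (hγ : ∀ i, 0 < γ i) (i : Fin 2) {s t : ℝ} (hs : 0 ≤ s) (hst : s ≤ t) (x : ℝ)
    {τ : ℕ → ℝ} (hτ : τ ∈ nonexplosive) :
    state a γ i ((t, x), cons (s, τ)) = state a γ (1 - i) ((t - s, flow a γ i s x), τ) := by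
  rw [state, state, chain_cons_of_le i hτ hst, position_eq_position_flow hγ
    (measurable_chain_right _ _) hs hst (fun v hv => chain_cons_of_lt i hτ hv)
    (fun v hv => chain_cons_of_le i hτ hv)]

lemma lintegral_expMeasure {r : ℝ} {f : ℝ → ENNReal} (hf : Measurable f) :
    ∫⁻ s, f s ∂(expMeasure r)
      = ∫⁻ s in Ioi 0, ENNReal.ofReal (r * Real.exp (-(r * s))) * f s := by
  have h0 : expMeasure r = volume.withDensity (exponentialPDF r) := rfl
  have hm : Measurable (exponentialPDF r) := (measurable_exponentialPDFReal r).ennreal_ofReal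
  rw [h0, lintegral_withDensity_eq_lintegral_mul _ hm hf,
    setLIntegral_congr (Ioi_ae_eq_Ici (a := (0 : ℝ))), ← lintegral_indicator measurableSet_Ici]
  refine lintegral_congr fun s => ?_
  by_cases hs : 0 ≤ s
  · rw [indicator_of_mem (mem_Ici.2 hs), Pi.mul_apply, exponentialPDF_of_nonneg hs]
  · rw [indicator_of_notMem (by simpa using hs), Pi.mul_apply, exponentialPDF_of_neg (not_le.1 hs),
      zero_mul]

lemma lintegral_Ioi_exp {r : ℝ} (hr : 0 < r) (t : ℝ) :
    ∫⁻ s in Ioi t, ENNReal.ofReal (r * Real.exp (-(r * s)))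
      = ENNReal.ofReal (Real.exp (-(r * t))) := by
  have hint : IntegrableOn (fun s => r * Real.exp (-(r * s))) (Ioi t) := by
    simp only [neg_mul_eq_neg_mul]
    exact (exp_neg_integrableOn_Ioi t hr).const_mul r
  rw [← ofReal_integral_eq_lintegral_ofReal hint
    (Filter.Eventually.of_forall fun s => by positivity), integral_const_mul]
  simp only [neg_mul_eq_neg_mul]
  rw [integral_exp_mul_Ioi (by linarith) t]
  congr 1
  field_simp

/-- The renewal equation obtained by conditioning on the time of the first switch. -/
theorem transition_renewal (hlam : ∀ i, 0 < lam i) (hγ : ∀ i, 0 < γ i) (i : Fin 2) {t : ℝ}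
    (ht : 0 ≤ t) (x : ℝ) {B : Set (ℝ × Fin 2)} (hB : MeasurableSet B) :
    transition lam a γ t (x, i) B
      = ENNReal.ofReal (Real.exp (-(lam i * t))) * B.indicator 1 (flow a γ i t x, i)
        + ∫⁻ s in Ioo 0 t, ENNReal.ofReal (lam i * Real.exp (-(lam i * s)))
            * transition lam a γ (t - s) (flow a γ i s x, 1 - i) B := by
  have := isProbabilityMeasure_holdingLaw hlam (1 - i)
  have hS : MeasurableSet (Prod.mk (t, x) ⁻¹' (state a γ i ⁻¹' B)) :=
    measurable_prodMk_left (measurable_state a γ i hB)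
  have hS' := measurable_cons hS
  have hae := ae_nonexplosive hlam (1 - i)
  rw [transition_apply a γ i lam t x hB, holdingLaw_eq_map_cons hlam,
    Measure.map_apply measurable_cons hS, Measure.prod_apply hS',
    lintegral_expMeasure (measurable_measure_prodMk_left hS'),
    ← Ioc_union_Ioi_eq_Ioi ht, lintegral_union measurableSet_Ioi
      (Set.disjoint_left.2 fun s hs hs' => not_lt.2 hs.2 hs'), add_comm,
      setLIntegral_congr (Ioo_ae_eq_Ioc (a := (0 : ℝ)) (b := t)).symm]
  congr 1
  -- First switch after `t`: the state at `t` is almost surely the deterministic `(flow a γ i t x,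
  -- i)`, so the inner probability is 0 or 1.
  · rw [← lintegral_Ioi_exp (hlam i) t, ← lintegral_mul_const _ (by fun_prop)]
    refine setLIntegral_congr_fun measurableSet_Ioi fun s hs => ?_
    congr 1
    rw [mem_Ioi] at hs
    by_cases hb : (flow a γ i t x, i) ∈ B
    · rw [indicator_of_mem hb, Pi.one_apply, ← measure_univ (μ := holdingLaw lam (1 - i))]
      refine measure_congr ?_
      filter_upwards [hae] with τ hτ
      refine propext ⟨fun _ => trivial, fun _ => ?_⟩
      change state a γ i ((t, x), cons (s, τ)) ∈ B
      rwa [state_cons_of_lt hγ i ht hs x hτ]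
    · rw [indicator_of_notMem hb]
      refine measure_eq_zero_iff_ae_notMem.2 ?_
      filter_upwards [hae] with τ hτ
      change state a γ i ((t, x), cons (s, τ)) ∉ B
      rwa [state_cons_of_lt hγ i ht hs x hτ]
  · refine setLIntegral_congr_fun measurableSet_Ioo fun s hs => ?_
    congr 1
    rw [transition_apply a γ (1 - i) lam _ _ hB]
    refine measure_congr ?_
    filter_upwards [hae] with τ hτ
    have := state_cons_of_le (a := a) hγ i hs.1.le hs.2.le x hτ
    exact congrArg (· ∈ B) this

lemma isProbabilityMeasure_transition (hlam : ∀ i, 0 < lam i) (t : ℝ) (z : ℝ × Fin 2) :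
    IsProbabilityMeasure (transition lam a γ t z) := by
  have := isProbabilityMeasure_holdingLaw hlam z.2
  exact Measure.isProbabilityMeasure_map
    ((measurable_state a γ z.2).comp (measurable_prodMk_left (x := (t, z.1)))).aemeasurable

end Renewal

/-! ### Balance of the beta densities at the last switch. -/

/-- The unnormalised beta profile `u ^ (α - 1) * (1 - u) ^ β` on `(0, 1)`. -/
noncomputable def profile (α β u : ℝ) : ℝ :=
  (Ioo (0 : ℝ) 1).indicator (fun u => u ^ (α - 1) * (1 - u) ^ β) u

lemma measurable_profile (α β : ℝ) : Measurable (profile α β) := by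
  have : Measurable fun u : ℝ => u ^ (α - 1) * (1 - u) ^ β := by fun_prop
  exact this.indicator measurableSet_Ioo

lemma profile_nonneg (α β u : ℝ) : 0 ≤ profile α β u :=
  indicator_nonneg (fun u hu => mul_nonneg (Real.rpow_nonneg hu.1.le _)
    (Real.rpow_nonneg (by linarith [hu.2]) _)) u

lemma profile_of_nonpos {α β u : ℝ} (hu : u ≤ 0) : profile α β u = 0 :=
  indicator_of_notMem (fun h => not_lt.2 hu h.1) _

lemma profile_of_one_le {α β u : ℝ} (hu : 1 ≤ u) : profile α β u = 0 :=
  indicator_of_notMem (fun h => not_lt.2 hu h.2) _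

lemma profile_of_mem {α β u : ℝ} (hu : u ∈ Ioo (0 : ℝ) 1) :
    profile α β u = u ^ (α - 1) * (1 - u) ^ β :=
  indicator_of_mem hu _

/-- Freezing the factor `u ^ (α - 1)` makes the rate of loss along the backward trajectory exactly
the profile of the other state, with exponents swapped and coordinate reflected. -/
lemma hasDerivAt_profile {α β u g : ℝ} (hu : 0 < u) {s : ℝ} (hs : u * Real.exp (g * s) < 1) :
    HasDerivAt (fun s => -(u ^ (α - 1) * (1 - u * Real.exp (g * s)) ^ β))
      (g * β * Real.exp ((g - α * g) * s) * profile β α (1 - u * Real.exp (g * s))) s := by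
  have he : 0 < u * Real.exp (g * s) := by positivity
  have h1 : HasDerivAt (fun s => 1 - u * Real.exp (g * s)) (-(u * (Real.exp (g * s) * g))) s := by
    have := (((hasDerivAt_id s).const_mul g).exp.const_mul u).const_sub 1
    simpa only [id_eq, mul_one] using this
  have h2 := ((h1.rpow_const (p := β) (Or.inl (by linarith))).const_mul (u ^ (α - 1))).neg
  convert! h2 using 1
  rw [profile_of_mem ⟨by linarith, by linarith⟩, sub_sub_cancel,
    Real.mul_rpow hu.le (Real.exp_pos _).le, ← Real.exp_mul]
  have h3 : Real.exp ((g - α * g) * s) * Real.exp (g * s * α) = Real.exp (g * s) := by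
    rw [← Real.exp_add]; congr 1; ring
  have h4 : u ^ α = u ^ (α - 1) * u := by rw [Real.rpow_sub_one hu.ne']; field_simp
  rw [h4, ← h3]
  ring

/-- The balance between the states along a trajectory of the flow run backwards in time. -/
lemma profile_balance {α β g : ℝ} (hβ : 0 < β) (hg : 0 < g) {t : ℝ} (ht : 0 ≤ t)
    (u : ℝ) :
    ENNReal.ofReal (profile α β u)
      = ENNReal.ofReal (Real.exp ((g - α * g) * t) * profile α β (u * Real.exp (g * t)))
        + ∫⁻ s in Ioo 0 t, ENNReal.ofReal
            (g * β * Real.exp ((g - α * g) * s) * profile β α (1 - u * Real.exp (g * s))) := by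
  have hexp : ∀ s : ℝ, 0 ≤ s → 1 ≤ Real.exp (g * s) := fun s hs =>
    Real.one_le_exp (mul_nonneg hg.le hs)
  rcases le_or_gt u 0 with hu | hu
  · have h1 : ∀ s, u * Real.exp (g * s) ≤ 0 := fun s =>
      mul_nonpos_of_nonpos_of_nonneg hu (Real.exp_pos _).le
    have h2 : ∀ s, 1 ≤ 1 - u * Real.exp (g * s) := fun s => by linarith [h1 s]
    simp [profile_of_nonpos hu, profile_of_nonpos (h1 _), profile_of_one_le (h2 _)]
  set F : ℝ → ENNReal := fun s => ENNReal.ofReal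
    (g * β * Real.exp ((g - α * g) * s) * profile β α (1 - u * Real.exp (g * s))) with hF
  have hzero : ∀ s, 1 ≤ u * Real.exp (g * s) → F s = 0 := fun s hs => by
    rw [hF]; simp only [profile_of_nonpos (show 1 - u * Real.exp (g * s) ≤ 0 by linarith)]; simp
  rcases le_or_gt 1 u with hu1 | hu1
  · have h1 : ∀ s, 0 ≤ s → 1 ≤ u * Real.exp (g * s) := fun s hs => by nlinarith [hexp s hs]
    rw [profile_of_one_le hu1, profile_of_one_le (h1 t ht),
      setLIntegral_congr_fun measurableSet_Ioo fun s hs => hzero s (h1 s hs.1.le)]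
    simp
  -- `T'` is the time at which the backward trajectory leaves the unit interval; from then on all
  -- profiles vanish.
  obtain ⟨T', hT'⟩ : ∃ T', u * Real.exp (g * T') = 1 := ⟨-Real.log u / g, by
    rw [mul_div_cancel₀ _ hg.ne', Real.exp_neg, Real.exp_log hu, mul_inv_cancel₀ hu.ne']⟩
  have hT'0 : 0 ≤ T' := by
    by_contra hneg
    have : Real.exp (g * T') ≤ 1 := Real.exp_le_one_iff.2 (by nlinarith)
    nlinarith
  have hmono : ∀ {s r : ℝ}, s ≤ r → u * Real.exp (g * s) ≤ u * Real.exp (g * r) := fun hsr =>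
    mul_le_mul_of_nonneg_left (Real.exp_le_exp.2 (mul_le_mul_of_nonneg_left hsr hg.le)) hu.le
  have hlt : ∀ {s : ℝ}, s < T' → u * Real.exp (g * s) < 1 := fun {s} hs => by
    rw [← hT']
    exact mul_lt_mul_of_pos_left (Real.exp_lt_exp.2 (mul_lt_mul_of_pos_left hs hg)) hu
  set T := min t T' with hT
  have hT0 : 0 ≤ T := le_min ht hT'0
  set h : ℝ → ℝ := fun s => u ^ (α - 1) * (1 - u * Real.exp (g * s)) ^ β with hh
  set F' : ℝ → ℝ := fun s =>
    g * β * Real.exp ((g - α * g) * s) * profile β α (1 - u * Real.exp (g * s)) with hF'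
  have hF'0 : ∀ s, 0 ≤ F' s := fun s =>
    mul_nonneg (by positivity) (profile_nonneg _ _ _)
  have hcont : ContinuousOn (fun s => -h s) (Icc 0 T) := by
    refine ((continuous_const.mul (Continuous.rpow_const (by fun_prop) fun s => ?_)).neg).continuousOn
    exact Or.inr hβ.le
  have hder : ∀ s ∈ Ioo 0 T, HasDerivAt (fun s => -h s) (F' s) s := fun s hs =>
    hasDerivAt_profile hu (hlt (hs.2.trans_le (min_le_right _ _)))
  -- If `β < 1` and `T = T'`, the derivative is unbounded near `T`; its sign and the continuity of
  -- the primitive still give integrability.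
  have hint : IntegrableOn F' (Ioc 0 T) :=
    intervalIntegral.integrableOn_deriv_of_nonneg hcont hder fun s _ => hF'0 s
  have hval : ∫ s in (0 : ℝ)..T, F' s = h 0 - h T := by
    rw [intervalIntegral.integral_eq_sub_of_hasDerivAt_of_le hT0 hcont hder
      ((intervalIntegrable_iff_integrableOn_Ioc_of_le hT0).2 hint)]
    ring
  have hle : h T ≤ h 0 := by
    have := intervalIntegral.integral_nonneg_of_forall (μ := volume) hT0 hF'0
    linarith
  have hres : ∫⁻ s in Ioo 0 t, F s = ENNReal.ofReal (h 0 - h T) := by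
    rw [← hval, intervalIntegral.integral_of_le hT0, ofReal_integral_eq_lintegral_ofReal hint
      (Filter.Eventually.of_forall hF'0), setLIntegral_congr Ioo_ae_eq_Ioc.symm,
      ← lintegral_indicator measurableSet_Ioo, ← lintegral_indicator measurableSet_Ioo]
    refine lintegral_congr fun s => ?_
    by_cases hs : s ∈ Ioo 0 T
    · rw [indicator_of_mem hs, indicator_of_mem (s := Ioo 0 t) ⟨hs.1, hs.2.trans_le (min_le_left _ _)⟩]
    · rw [indicator_of_notMem hs]
      by_cases hs' : s ∈ Ioo 0 t
      · rw [indicator_of_mem hs']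
        refine hzero s ?_
        have : T' ≤ s := by
          by_contra hc
          exact hs ⟨hs'.1, lt_min hs'.2 (not_le.1 hc)⟩
        rw [← hT']
        exact hmono this
      · rw [indicator_of_notMem hs']
  -- Before exit the exponential prefactor cancels the growth of `(u * exp (g * t)) ^ (α - 1)`.
  -- After exit both sides are 0, the left one because `0 ^ β = 0` for `β > 0`.
  have hT1 : h T = Real.exp ((g - α * g) * t) * profile α β (u * Real.exp (g * t)) := by
    rcases lt_or_ge t T' with htT | htT
    · rw [hT, min_eq_left htT.le, profile_of_mem ⟨by positivity, hlt htT⟩, hh,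
        Real.mul_rpow hu.le (Real.exp_pos _).le, ← Real.exp_mul]
      have : Real.exp ((g - α * g) * t) * Real.exp (g * t * (α - 1)) = 1 := by
        rw [← Real.exp_add, Real.exp_eq_one_iff]; ring
      linear_combination (-u ^ (α - 1) * (1 - u * Real.exp (g * t)) ^ β) * this
    · rw [hT, min_eq_right htT, profile_of_one_le (by rw [← hT']; exact hmono htT), hh]
      simp only [hT', sub_self, Real.zero_rpow hβ.ne', mul_zero]
  have hT2 : 0 ≤ h T := hT1 ▸ mul_nonneg (Real.exp_pos _).le (profile_nonneg _ _ _)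
  have h0 : profile α β u = h 0 := by
    rw [profile_of_mem ⟨hu, hu1⟩, hh]; simp
  rw [hres, ← hT1, h0, ← ENNReal.ofReal_add hT2 (by linarith)]
  congr 1; ring

lemma lintegral_comp_affine (f : ℝ → ENNReal) {k : ℝ} (hk : k ≠ 0) (b d : ℝ) :
    ∫⁻ y, ENNReal.ofReal |k| * f (d + (y - b) * k) = ∫⁻ x, f x := by
  have hd : ∀ y ∈ univ, HasDerivWithinAt (fun y : ℝ => d + (y - b) * k) k univ y := fun y _ => by
    have := ((((hasDerivAt_id y).sub_const b).mul_const k).const_add d).hasDerivWithinAt (s := univ)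
    simpa only [id_eq, one_mul] using this
  have hinj : InjOn (fun y : ℝ => d + (y - b) * k) univ := fun y _ z _ hyz => by
    have := mul_right_cancel₀ hk (add_left_cancel hyz)
    linarith
  have himg : (fun y : ℝ => d + (y - b) * k) '' univ = univ := by
    refine eq_univ_of_forall fun x => ⟨b + (x - d) / k, trivial, ?_⟩
    field_simp; ring
  have := lintegral_image_eq_lintegral_abs_deriv_mul MeasurableSet.univ hd hinj f
  rw [himg, setLIntegral_univ, setLIntegral_univ] at this
  exact this.symm

/-- The density at `x` of the part of the invariant measure that lives on state `i`. -/
noncomputable def density (C : ℝ) (γ ρ α : Fin 2 → ℝ) (i : Fin 2) (x : ℝ) : ℝ :=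
  C / γ i * profile (α i) (α (1 - i)) ((x - ρ i) / (ρ (1 - i) - ρ i))

lemma measurable_density (C : ℝ) (γ ρ α : Fin 2 → ℝ) (i : Fin 2) :
    Measurable (density C γ ρ α i) := by
  have := measurable_profile (α i) (α (1 - i))
  unfold density
  fun_prop

section Balance

variable {lam a γ ρ α : Fin 2 → ℝ} {C : ℝ}

lemma density_nonneg (hγ : ∀ i, 0 < γ i) (hC : 0 ≤ C) (i : Fin 2) (x : ℝ) :
    0 ≤ density C γ ρ α i x :=
  mul_nonneg (div_nonneg hC (hγ i).le) (profile_nonneg _ _ _)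

lemma one_sub_one_sub (i : Fin 2) : 1 - (1 - i) = i := sub_sub_cancel 1 i

/-- The flow is affine about `ρ i`; its inverse expands by `exp (γ i * s)`, which is also the
Jacobian. -/
lemma lintegral_mul_comp_flow (hρ : ∀ i, ρ i = a i / γ i) (i : Fin 2) (s : ℝ)
    (D : ℝ → ℝ) (f : ℝ → ENNReal) :
    ∫⁻ x, ENNReal.ofReal (D x) * f (flow a γ i s x)
      = ∫⁻ y, ENNReal.ofReal (Real.exp (γ i * s) * D (ρ i + (y - ρ i) * Real.exp (γ i * s)))
          * f y := by
  rw [← lintegral_comp_affine _ (Real.exp_pos (γ i * s)).ne' (ρ i) (ρ i)]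
  refine lintegral_congr fun y => ?_
  have h1 : flow a γ i s (ρ i + (y - ρ i) * Real.exp (γ i * s)) = y := by
    rw [flow, ← hρ, add_sub_cancel_left, mul_assoc, ← Real.exp_add, add_neg_cancel, Real.exp_zero]
    ring
  rw [h1, abs_of_pos (Real.exp_pos _), ← mul_assoc, ENNReal.ofReal_mul (Real.exp_pos _).le]

lemma density_balance (hlam : ∀ i, 0 < lam i) (hγ : ∀ i, 0 < γ i) (hα : ∀ i, α i = lam i / γ i)
    (hρ01 : ρ 0 < ρ 1) (hC : 0 ≤ C) (i : Fin 2) {t : ℝ} (ht : 0 ≤ t) (y : ℝ) :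
    ENNReal.ofReal (density C γ ρ α i y)
      = ENNReal.ofReal (Real.exp (-(lam i * t))) * ENNReal.ofReal (Real.exp (γ i * t)
            * density C γ ρ α i (ρ i + (y - ρ i) * Real.exp (γ i * t)))
        + ∫⁻ s in Ioo 0 t, ENNReal.ofReal (lam (1 - i) * Real.exp (-(lam i * s)))
          * ENNReal.ofReal (Real.exp (γ i * s)
            * density C γ ρ α (1 - i) (ρ i + (y - ρ i) * Real.exp (γ i * s))) := by
  have hne : ρ (1 - i) - ρ i ≠ 0 := by
    fin_cases i
    · simpa using (sub_pos.2 hρ01).ne'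
    · simpa using (sub_neg.2 hρ01).ne
  have hne' : ρ i - ρ (1 - i) ≠ 0 := by rw [← neg_sub]; exact neg_ne_zero.2 hne
  have hαpos : ∀ j, 0 < α j := fun j => by rw [hα]; exact div_pos (hlam j) (hγ j)
  have hl : ∀ j, lam j = α j * γ j := fun j => by rw [hα, div_mul_cancel₀ _ (hγ j).ne']
  have hγi := hγ i
  have hγ' := hγ (1 - i)
  set u := (y - ρ i) / (ρ (1 - i) - ρ i) with hu
  have hCi : 0 ≤ C / γ i := div_nonneg hC hγi.le
  have e1 : ∀ k : ℝ, (ρ i + (y - ρ i) * k - ρ i) / (ρ (1 - i) - ρ i) = u * k := fun k => by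
    rw [hu]; ring
  -- The unit coordinates of the two states are reflections of each other, which turns the claim
  -- into `profile_balance`.
  have e2 : ∀ k : ℝ, (ρ i + (y - ρ i) * k - ρ (1 - i)) / (ρ i - ρ (1 - i)) = 1 - u * k := fun k => by
    rw [hu]; field_simp; ring
  have e3 : ∀ s, Real.exp (-(lam i * s)) * Real.exp (γ i * s)
      = Real.exp ((γ i - α i * γ i) * s) := fun s => by
    rw [← Real.exp_add, hl]; congr 1; ring
  have hb := profile_balance (α := α i) (hαpos (1 - i)) hγi ht u
  have hb2 := congrArg (ENNReal.ofReal (C / γ i) * ·) hb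
  have hm : Measurable (profile (α (1 - i)) (α i)) := measurable_profile _ _
  rw [mul_add, ← ENNReal.ofReal_mul hCi, ← ENNReal.ofReal_mul hCi,
    ← lintegral_const_mul _ (by fun_prop)] at hb2
  rw [density, ← hu, hb2]
  congr 1
  · rw [← ENNReal.ofReal_mul (Real.exp_pos _).le, density, e1, ← e3]
    congr 1; ring
  · refine setLIntegral_congr_fun measurableSet_Ioo fun s _ => ?_
    rw [← ENNReal.ofReal_mul hCi, ← ENNReal.ofReal_mul (mul_pos (hlam _) (Real.exp_pos _)).le,
      density, one_sub_one_sub, e2, ← e3, hl (1 - i)]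
    congr 1
    field_simp

/-- The equation satisfied by the invariant densities, obtained by conditioning on the time of the
last switch. -/
theorem lintegral_density_balance (hlam : ∀ i, 0 < lam i) (hγ : ∀ i, 0 < γ i)
    (hρ : ∀ i, ρ i = a i / γ i) (hα : ∀ i, α i = lam i / γ i)
    (hρ01 : ρ 0 < ρ 1) (hC : 0 ≤ C) (i : Fin 2) {t : ℝ} (ht : 0 ≤ t) {f : ℝ → ENNReal}
    (hf : Measurable f) :
    ∫⁻ x, ENNReal.ofReal (density C γ ρ α i x) * f x
      = ENNReal.ofReal (Real.exp (-(lam i * t)))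
          * (∫⁻ x, ENNReal.ofReal (density C γ ρ α i x) * f (flow a γ i t x))
        + ∫⁻ s in Ioo 0 t, ENNReal.ofReal (lam (1 - i) * Real.exp (-(lam i * s)))
          * ∫⁻ x, ENNReal.ofReal (density C γ ρ α (1 - i) x) * f (flow a γ i s x) := by
  have hD := measurable_density C γ ρ α
  simp_rw [lintegral_mul_comp_flow hρ]
  have hD0 := hD i
  have hD1 := hD (1 - i)
  simp_rw [density_balance hlam hγ hα hρ01 hC i ht]
  simp_rw [add_mul]
  rw [lintegral_add_left (by fun_prop)]
  congr 1
  · rw [← lintegral_const_mul _ (by fun_prop)]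
    simp_rw [mul_assoc]
  · have h1 : ∀ y, (∫⁻ s in Ioo 0 t, ENNReal.ofReal (lam (1 - i) * Real.exp (-(lam i * s)))
          * ENNReal.ofReal (Real.exp (γ i * s)
            * density C γ ρ α (1 - i) (ρ i + (y - ρ i) * Real.exp (γ i * s)))) * f y
        = ∫⁻ s in Ioo 0 t, ENNReal.ofReal (lam (1 - i) * Real.exp (-(lam i * s)))
          * (ENNReal.ofReal (Real.exp (γ i * s)
            * density C γ ρ α (1 - i) (ρ i + (y - ρ i) * Real.exp (γ i * s))) * f y) := fun y => by
      rw [← lintegral_mul_const _ (by fun_prop)]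
      simp_rw [mul_assoc]
    simp_rw [h1]
    rw [lintegral_lintegral_swap (by fun_prop)]
    refine lintegral_congr fun s => ?_
    rw [lintegral_const_mul _ (by fun_prop)]

end Balance

/-! ### Duality between first and last switches. -/

lemma setLIntegral_Ioo_reflect (f : ℝ → ENNReal) (t : ℝ) :
    ∫⁻ u in Ioo 0 t, f (t - u) = ∫⁻ s in Ioo 0 t, f s := by
  rw [← lintegral_indicator measurableSet_Ioo, ← lintegral_indicator measurableSet_Ioo,
    ← lintegral_sub_left_eq_self ((Ioo 0 t).indicator f) t]
  refine lintegral_congr fun u => ?_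
  have : t - u ∈ Ioo 0 t ↔ u ∈ Ioo 0 t := by
    simp only [mem_Ioo]; constructor <;> rintro ⟨h1, h2⟩ <;> constructor <;> linarith
  by_cases h : u ∈ Ioo 0 t
  · rw [indicator_of_mem h, indicator_of_mem (this.2 h)]
  · rw [indicator_of_notMem h, indicator_of_notMem (fun h' => h (this.1 h'))]

/-- Change of variables `(r, u) ↦ (r, u + r)` on a triangle. -/
lemma lintegral_triangle {K : ℝ × ℝ → ENNReal} (hK : Measurable K) (t : ℝ) :
    ∫⁻ u in Ioo 0 t, ∫⁻ r in Ioo 0 (t - u), K (r, u)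
      = ∫⁻ v in Ioo 0 t, ∫⁻ r in Ioo 0 v, K (r, v - r) := by
  -- Both iterated integrals are the integral of `K` over this triangle; translation by `r`
  -- identifies them.
  set S : Set (ℝ × ℝ) := {w | 0 < w.1 ∧ 0 < w.2 ∧ w.1 + w.2 < t} with hS
  have hSm : MeasurableSet S :=
    (measurableSet_lt measurable_const measurable_fst).inter
      ((measurableSet_lt measurable_const measurable_snd).inter
        (measurableSet_lt (measurable_fst.add measurable_snd) measurable_const))
  have hm : Measurable (S.indicator K) := hK.indicator hSm
  have h1 : ∫⁻ u in Ioo 0 t, ∫⁻ r in Ioo 0 (t - u), K (r, u)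
      = ∫⁻ u, ∫⁻ r, S.indicator K (r, u) := by
    rw [← lintegral_indicator measurableSet_Ioo]
    refine lintegral_congr fun u => ?_
    by_cases hu : u ∈ Ioo 0 t
    · rw [indicator_of_mem hu, ← lintegral_indicator measurableSet_Ioo]
      refine lintegral_congr fun r => ?_
      by_cases hr : r ∈ Ioo 0 (t - u)
      · rw [indicator_of_mem hr,
          indicator_of_mem (s := S) ⟨hr.1, hu.1, by have := hr.2; simp only; linarith⟩]
      · rw [indicator_of_notMem hr, indicator_of_notMem]
        rintro ⟨a1, -, a3⟩
        exact hr ⟨a1, by simp only at a3; linarith⟩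
    · rw [indicator_of_notMem hu]
      refine (lintegral_eq_zero_of_ae_eq_zero (Filter.Eventually.of_forall fun r => ?_)).symm
      rw [indicator_of_notMem]
      · rfl
      · rintro ⟨a1, a2, a3⟩
        exact hu ⟨a2, by simp only at a1 a3; linarith⟩
  have h2 : ∫⁻ v in Ioo 0 t, ∫⁻ r in Ioo 0 v, K (r, v - r)
      = ∫⁻ v, ∫⁻ r, S.indicator K (r, v - r) := by
    rw [← lintegral_indicator measurableSet_Ioo]
    refine lintegral_congr fun v => ?_
    by_cases hv : v ∈ Ioo 0 t
    · rw [indicator_of_mem hv, ← lintegral_indicator measurableSet_Ioo]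
      refine lintegral_congr fun r => ?_
      by_cases hr : r ∈ Ioo 0 v
      · rw [indicator_of_mem hr, indicator_of_mem (s := S)
          ⟨hr.1, by have := hr.2; simp only; linarith, by have := hv.2; simp only; linarith⟩]
      · rw [indicator_of_notMem hr, indicator_of_notMem]
        rintro ⟨a1, a2, -⟩
        exact hr ⟨a1, by simp only at a2; linarith⟩
    · rw [indicator_of_notMem hv]
      refine (lintegral_eq_zero_of_ae_eq_zero (Filter.Eventually.of_forall fun r => ?_)).symm
      rw [indicator_of_notMem]
      · rfl
      · rintro ⟨a1, a2, a3⟩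
        exact hv ⟨by simp only at a1 a2; linarith, by simp only at a3; linarith⟩
  rw [h1, h2, lintegral_lintegral_swap (f := fun u r => S.indicator K (r, u)) (by fun_prop),
    lintegral_lintegral_swap (f := fun v r => S.indicator K (r, v - r)) (by fun_prop)]
  refine lintegral_congr fun r => ?_
  exact (lintegral_sub_right_eq_self (fun u => S.indicator K (r, u)) r).symm

section Duality

variable {l : Fin 2 → ENNReal} {e : Fin 2 → ℝ → ENNReal} {φ : Fin 2 → ℝ × ℝ → ℝ}
  {D b : Fin 2 → ℝ → ENNReal} {G : Fin 2 → ℝ × ℝ → ENNReal}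

lemma lintegral_renewal (he : ∀ i, Measurable (e i)) (hφ : ∀ i, Measurable (φ i))
    (hb : ∀ i, Measurable (b i)) (hG : ∀ i, Measurable (G i)) {d : ℝ → ENNReal} (hd : Measurable d)
    (hren : ∀ i t x, 0 ≤ t → G i (t, x) = e i t * b i (φ i (t, x))
      + ∫⁻ s in Ioo 0 t, l i * e i s * G (1 - i) (t - s, φ i (s, x)))
    (i : Fin 2) {t : ℝ} (ht : 0 ≤ t) :
    ∫⁻ x, d x * G i (t, x) = e i t * (∫⁻ x, d x * b i (φ i (t, x)))
      + ∫⁻ s in Ioo 0 t, l i * e i s * ∫⁻ x, d x * G (1 - i) (t - s, φ i (s, x)) := by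
  have h1 := he i
  have h2 := hφ i
  have h3 := hb i
  have h4 := hG (1 - i)
  simp_rw [hren i t _ ht, mul_add]
  rw [lintegral_add_left (by fun_prop), ← lintegral_const_mul _ (by fun_prop)]
  congr 1
  · refine lintegral_congr fun x => ?_
    ring
  · have : ∀ x, d x * ∫⁻ s in Ioo 0 t, l i * e i s * G (1 - i) (t - s, φ i (s, x))
        = ∫⁻ s in Ioo 0 t, l i * e i s * (d x * G (1 - i) (t - s, φ i (s, x))) := fun x => by
      rw [← lintegral_const_mul _ (by fun_prop)]
      refine lintegral_congr fun s => ?_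
      ring
    simp_rw [this]
    rw [lintegral_lintegral_swap (by fun_prop)]
    refine lintegral_congr fun s => ?_
    rw [lintegral_const_mul _ (by fun_prop)]

/-- Comparison of the decomposition of `G` at the first switch with the decomposition of `D` at the
last switch. -/
lemma lintegral_add_flux (he : ∀ i, Measurable (e i)) (hφ : ∀ i, Measurable (φ i))
    (hb : ∀ i, Measurable (b i)) (hG : ∀ i, Measurable (G i)) (hD : ∀ i, Measurable (D i))
    (hren : ∀ i t x, 0 ≤ t → G i (t, x) = e i t * b i (φ i (t, x))
      + ∫⁻ s in Ioo 0 t, l i * e i s * G (1 - i) (t - s, φ i (s, x)))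
    (hbal : ∀ i t, 0 ≤ t → ∀ f : ℝ → ENNReal, Measurable f →
      ∫⁻ x, D i x * f x = e i t * (∫⁻ x, D i x * f (φ i (t, x)))
        + ∫⁻ s in Ioo 0 t, l (1 - i) * e i s * ∫⁻ x, D (1 - i) x * f (φ i (s, x)))
    (i : Fin 2) {t : ℝ} (ht : 0 ≤ t) :
    (∫⁻ x, D i x * G i (t, x)) + ∫⁻ u in Ioo 0 t, l (1 - i) * ∫⁻ x, D (1 - i) x * G i (u, x)
      = (∫⁻ x, D i x * b i x) + ∫⁻ u in Ioo 0 t, l i * ∫⁻ x, D i x * G (1 - i) (u, x) := by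
  have h1 := he i
  have h2 := hφ i
  have h3 := hb i
  have h4 := hG (1 - i)
  have h5 := hD i
  have h6 := hD (1 - i)
  have hA := lintegral_renewal he hφ hb hG h5 hren i ht
  -- This flux is expanded by the first switch of `G i`, the opposite flux `hE` by the last switch
  -- of `D i`. The double integrals agree by `htri`, the single ones match terms of `hbal` and `hA`.
  have hE' : ∫⁻ v in Ioo 0 t, l (1 - i) * ∫⁻ x, D (1 - i) x * G i (v, x)
      = (∫⁻ v in Ioo 0 t, l (1 - i) * e i v * ∫⁻ x, D (1 - i) x * b i (φ i (v, x)))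
        + ∫⁻ v in Ioo 0 t, ∫⁻ r in Ioo 0 v, l (1 - i) * (l i * e i r
          * ∫⁻ x, D (1 - i) x * G (1 - i) (v - r, φ i (r, x))) := by
    rw [← lintegral_add_left (by fun_prop)]
    refine setLIntegral_congr_fun measurableSet_Ioo fun v hv => ?_
    rw [lintegral_renewal he hφ hb hG h6 hren i hv.1.le, lintegral_const_mul _ (by fun_prop)]
    ring
  have hE : ∫⁻ u in Ioo 0 t, l i * ∫⁻ x, D i x * G (1 - i) (u, x)
      = (∫⁻ u in Ioo 0 t, l i * e i (t - u) * ∫⁻ x, D i x * G (1 - i) (u, φ i (t - u, x)))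
        + ∫⁻ u in Ioo 0 t, ∫⁻ r in Ioo 0 (t - u), l (1 - i) * (l i * e i r
          * ∫⁻ x, D (1 - i) x * G (1 - i) (u, φ i (r, x))) := by
    rw [← lintegral_add_left (by fun_prop)]
    refine setLIntegral_congr_fun measurableSet_Ioo fun u hu => ?_
    rw [hbal i (t - u) (by linarith [hu.2]) (fun x => G (1 - i) (u, x)) (by fun_prop), mul_add]
    congr 1
    · ring
    · rw [← lintegral_const_mul _ (by fun_prop)]
      refine lintegral_congr fun r => ?_
      ring
  have hrefl := setLIntegral_Ioo_reflect
    (fun s => l i * e i s * ∫⁻ x, D i x * G (1 - i) (t - s, φ i (s, x))) t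
  simp only [sub_sub_cancel] at hrefl
  have htri := lintegral_triangle (K := fun w => l (1 - i) * (l i * e i w.1
          * ∫⁻ x, D (1 - i) x * G (1 - i) (w.2, φ i (w.1, x)))) (by fun_prop) t
  simp only at htri
  rw [hA, hE', hE, hbal i t ht (b i) h3, hrefl, htri]
  ring

end Duality

/-! ### Invariance of the measure with beta densities. -/

/-- The measure on `ℝ × Fin 2` with densities `D 0` and `D 1`. -/
noncomputable def mixture (D : Fin 2 → ℝ → ENNReal) : Measure (ℝ × Fin 2) :=
  ∑ i, (volume.withDensity (D i)).map fun x => (x, i)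

lemma lintegral_mixture {D : Fin 2 → ℝ → ENNReal} (hD : ∀ i, Measurable (D i))
    {f : ℝ × Fin 2 → ENNReal} (hf : Measurable f) :
    ∫⁻ z, f z ∂(mixture D) = ∑ i, ∫⁻ x, D i x * f (x, i) := by
  rw [mixture, lintegral_finsetSum_measure]
  refine Finset.sum_congr rfl fun i _ => ?_
  have hi : Measurable fun x : ℝ => (x, i) := measurable_prodMk_right
  rw [lintegral_map hf hi, lintegral_withDensity_eq_lintegral_mul _ (hD i)
    (g := fun x => f (x, i)) (hf.comp hi)]
  rfl

lemma mixture_apply {D : Fin 2 → ℝ → ENNReal} (hD : ∀ i, Measurable (D i))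
    {B : Set (ℝ × Fin 2)} (hB : MeasurableSet B) :
    mixture D B = ∑ i, ∫⁻ x, D i x * B.indicator 1 (x, i) := by
  rw [← lintegral_indicator_one hB, lintegral_mixture hD (measurable_one.indicator hB)]

section Invariance

variable {lam a γ ρ α : Fin 2 → ℝ} {C : ℝ}

lemma measurable_transition_apply (hlam : ∀ i, 0 < lam i) (t : ℝ) {B : Set (ℝ × Fin 2)}
    (hB : MeasurableSet B) : Measurable fun z => transition lam a γ t z B :=
  measurable_from_prod_countable_left fun i =>
    (measurable_transition a γ i hlam hB).comp measurable_prodMk_left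

theorem isInvariant_mixture_density (hlam : ∀ i, 0 < lam i) (hγ : ∀ i, 0 < γ i)
    (hρ : ∀ i, ρ i = a i / γ i) (hα : ∀ i, α i = lam i / γ i)
    (hρ01 : ρ 0 < ρ 1) (hC : 0 ≤ C)
    (hfin : ∀ i, ∫⁻ x, ENNReal.ofReal (density C γ ρ α i x) ≠ ⊤) :
    IsInvariant lam a γ (mixture fun i x => ENNReal.ofReal (density C γ ρ α i x)) := by
  intro t ht B hB
  set D : Fin 2 → ℝ → ENNReal := fun i x => ENNReal.ofReal (density C γ ρ α i x) with hDdef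
  have hD : ∀ i, Measurable (D i) := fun i => (measurable_density C γ ρ α i).ennreal_ofReal
  rw [mixture_apply hD hB, lintegral_mixture hD (measurable_transition_apply hlam t hB)]
  have hmul : ∀ i j s, ENNReal.ofReal (lam i * Real.exp (-(lam j * s)))
      = ENNReal.ofReal (lam i) * ENNReal.ofReal (Real.exp (-(lam j * s))) := fun i j s =>
    ENNReal.ofReal_mul (hlam i).le
  have key := lintegral_add_flux (l := fun i => ENNReal.ofReal (lam i))
    (e := fun i s => ENNReal.ofReal (Real.exp (-(lam i * s))))
    (φ := fun i z => flow a γ i z.1 z.2) (D := D) (b := fun i x => B.indicator 1 (x, i))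
    (G := fun i z => transition lam a γ z.1 (z.2, i) B)
    (fun i => by fun_prop) (measurable_flow a γ)
    (fun i => (measurable_one.indicator hB).comp measurable_prodMk_right)
    (fun i => measurable_transition a γ i hlam hB) hD
    (fun i t x ht => by simp_rw [← hmul]; exact transition_renewal hlam hγ i ht x hB)
    (fun i t ht f hf => by
      simp_rw [← hmul]; exact lintegral_density_balance hlam hγ hρ hα hρ01 hC i ht hf)
  have k0 := key 0 ht
  have k1 := key 1 ht
  simp only [sub_zero, sub_self] at k0 k1
  set E : Fin 2 → ENNReal := fun i => ∫⁻ u in Ioo 0 t, ENNReal.ofReal (lam i)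
    * ∫⁻ x, D i x * transition lam a γ u (x, 1 - i) B with hE
  -- Finiteness is what permits cancelling `E 0 + E 1` from the sum of the two flux identities in
  -- `ENNReal`.
  have hEfin : ∀ i, E i ≠ ⊤ := by
    intro i
    have hle : E i ≤ ∫⁻ u in Ioo 0 t, ENNReal.ofReal (lam i) * ∫⁻ x, D i x := by
      refine lintegral_mono fun u => mul_le_mul_right (lintegral_mono fun x => ?_) _
      have := isProbabilityMeasure_transition (a := a) (γ := γ) hlam u (x, 1 - i)
      exact mul_le_of_le_one_right' prob_le_one
    refine ne_top_of_le_ne_top ?_ hle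
    rw [setLIntegral_const]
    exact ENNReal.mul_ne_top (ENNReal.mul_ne_top ENNReal.ofReal_ne_top (hfin i)) (by simp)
  have e0 : E 0 = ∫⁻ u in Ioo 0 t, ENNReal.ofReal (lam 0)
    * ∫⁻ x, D 0 x * transition lam a γ u (x, 1) B := by simp [hE]
  have e1 : E 1 = ∫⁻ u in Ioo 0 t, ENNReal.ofReal (lam 1)
    * ∫⁻ x, D 1 x * transition lam a γ u (x, 0) B := by simp [hE]
  rw [← e0, ← e1] at k0 k1
  simp only [Fin.sum_univ_two]
  refine (ENNReal.add_left_inj (ENNReal.add_ne_top.2 ⟨hEfin 0, hEfin 1⟩)).1 ?_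
  rw [show ∀ p q r s : ENNReal, p + q + (r + s) = (p + r) + (q + s) from fun p q r s => by ring,
    ← k0, ← k1]
  ring

end Invariance

/-! ### Contraction under a common driving path. -/

section Contraction

variable {lam a γ : Fin 2 → ℝ}

lemma mul_le_Gam {e : ℝ → Fin 2} (he : Measurable e) {g t : ℝ} (ht : 0 ≤ t) (hg : ∀ i, g ≤ γ i) :
    g * t ≤ Gam γ e t := by
  have := intervalIntegral.integral_mono_on (μ := volume) ht (intervalIntegrable_const (c := g))
    (intervalIntegrable_comp he γ 0 t) fun s _ => hg (e s)
  simpa [Gam, mul_comm] using this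

/-- The equation is linear: along a fixed path the forcing terms cancel and only the starting
points, damped by `exp (-Γ(t))`, remain. -/
lemma abs_position_sub_le {e : ℝ → Fin 2} (he : Measurable e) {g t : ℝ} (ht : 0 ≤ t)
    (hg : ∀ i, g ≤ γ i) (x y : ℝ) :
    |position a γ e x t - position a γ e y t| ≤ |x - y| * Real.exp (-(g * t)) := by
  have h1 : position a γ e x t - position a γ e y t = (x - y) * Real.exp (-Gam γ e t) := by
    rw [position, position]; ring
  rw [h1, abs_mul, abs_of_pos (Real.exp_pos _)]
  exact mul_le_mul_of_nonneg_left
    (Real.exp_le_exp.2 (neg_le_neg (mul_le_Gam he ht hg))) (abs_nonneg _)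

lemma integral_transition (t x : ℝ) (i : Fin 2) {f : ℝ × Fin 2 → ℂ} (hf : Measurable f) :
    ∫ y, f y ∂(transition lam a γ t (x, i))
      = ∫ τ, f (state a γ i ((t, x), τ)) ∂(holdingLaw lam i) := by
  rw [transition_eq_map, integral_map _ hf.aestronglyMeasurable]
  exact ((measurable_state a γ i).comp measurable_prodMk_left).aemeasurable

lemma norm_integral_transition_sub_le (hlam : ∀ i, 0 < lam i) {g t : ℝ} (ht : 0 ≤ t)
    (hg : ∀ i, g ≤ γ i) {f : ℝ × Fin 2 → ℂ} (hf : Measurable f) {M L : ℝ} (hM : ∀ z, ‖f z‖ ≤ M)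
    (hL : 0 ≤ L) (hfL : ∀ x y i, ‖f (x, i) - f (y, i)‖ ≤ L * |x - y|) (x y : ℝ) (i : Fin 2) :
    ‖∫ w, f w ∂(transition lam a γ t (x, i)) - ∫ w, f w ∂(transition lam a γ t (y, i))‖
      ≤ L * (|x - y| * Real.exp (-(g * t))) := by
  have := isProbabilityMeasure_holdingLaw hlam i
  have hint : ∀ x, Integrable (fun τ => f (state a γ i ((t, x), τ))) (holdingLaw lam i) := fun x => by
    have hm : Measurable fun τ => f (state a γ i ((t, x), τ)) :=
      hf.comp ((measurable_state a γ i).comp measurable_prodMk_left)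
    exact Integrable.of_bound hm.aestronglyMeasurable M (Filter.Eventually.of_forall fun τ => hM _)
  rw [integral_transition t x i hf, integral_transition t y i hf,
    ← integral_sub (hint x) (hint y)]
  refine (norm_integral_le_of_norm_le_const (C := L * (|x - y| * Real.exp (-(g * t))))
    (Filter.Eventually.of_forall fun τ => ?_)).trans (by simp)
  exact (hfL _ _ _).trans (mul_le_mul_of_nonneg_left
    (abs_position_sub_le (measurable_chain_right i τ) ht hg x y) hL)

end Contraction

/-! ### Uniqueness of the invariant law. -/

section Uniqueness

variable {lam a γ : Fin 2 → ℝ}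

/-- The transition function as a Markov kernel. -/
noncomputable def transitionKernel (lam a γ : Fin 2 → ℝ) (hlam : ∀ i, 0 < lam i) (t : ℝ) :
    Kernel (ℝ × Fin 2) (ℝ × Fin 2) where
  toFun := transition lam a γ t
  measurable' := Measure.measurable_of_measurable_coe _ fun _ hB =>
    measurable_transition_apply hlam t hB

lemma isMarkovKernel_transitionKernel (hlam : ∀ i, 0 < lam i) (t : ℝ) :
    IsMarkovKernel (transitionKernel lam a γ hlam t) :=
  ⟨fun z => isProbabilityMeasure_transition hlam t z⟩

lemma IsInvariant.integral_eq (hlam : ∀ i, 0 < lam i) {ν : Measure (ℝ × Fin 2)}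
    (hν : IsInvariant lam a γ ν) {t : ℝ} (ht : 0 ≤ t) {f : ℝ × Fin 2 → ℂ} (hf : Integrable f ν) :
    ∫ y, f y ∂ν = ∫ z, ∫ y, f y ∂(transition lam a γ t z) ∂ν := by
  set κ := transitionKernel lam a γ hlam t with hκ
  have hbind : (κ ∘ₖ Kernel.const Unit ν) () = ν := by
    ext B hB
    rw [Kernel.comp_apply' _ _ _ hB, Kernel.const_apply]
    exact (hν t ht B hB).symm
  have h := Kernel.integral_comp (κ := Kernel.const Unit ν) (η := κ) (a := ()) (f := f)
    (by rwa [hbind])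
  rw [hbind, Kernel.const_apply] at h
  exact h

lemma lintegral_snd {ν : Measure (ℝ × Fin 2)} (q : Fin 2 → ENNReal) :
    ∫⁻ z, q z.2 ∂ν = q 0 * ν.map Prod.snd {0} + q 1 * ν.map Prod.snd {1} := by
  rw [← lintegral_map (f := q) (measurable_of_finite q) measurable_snd, lintegral_fintype,
    Fin.sum_univ_two]

lemma transition_univ_prod_pos (hlam : ∀ i, 0 < lam i) (hγ : ∀ i, 0 < γ i) (x : ℝ) :
    0 < transition lam a γ 1 (x, 1) (univ ×ˢ {0}) := by
  have hB : MeasurableSet ((univ : Set ℝ) ×ˢ ({0} : Set (Fin 2))) :=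
    MeasurableSet.univ.prod (measurableSet_singleton _)
  rw [transition_renewal hlam hγ 1 zero_le_one x hB]
  refine lt_of_lt_of_le ?_ le_add_self
  -- A lower bound for the density of a first switch at `s` followed by no further switch up to time
  -- 1.
  set k : ENNReal := ENNReal.ofReal (lam 1 * Real.exp (-lam 1)) * ENNReal.ofReal (Real.exp (-lam 0))
    with hk
  have hkpos : 0 < k := ENNReal.mul_pos
    (ENNReal.ofReal_pos.2 (mul_pos (hlam 1) (Real.exp_pos _))).ne'
    (ENNReal.ofReal_pos.2 (Real.exp_pos _)).ne'
  have hle : ∫⁻ _ in Ioo (0 : ℝ) 1, k ≤ ∫⁻ s in Ioo 0 1,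
      ENNReal.ofReal (lam 1 * Real.exp (-(lam 1 * s)))
        * transition lam a γ (1 - s) (flow a γ 1 s x, 1 - 1) (univ ×ˢ {0}) := by
    refine setLIntegral_mono' measurableSet_Ioo fun s hs => mul_le_mul' ?_ ?_
    · refine ENNReal.ofReal_le_ofReal (mul_le_mul_of_nonneg_left (Real.exp_le_exp.2 ?_) (hlam 1).le)
      nlinarith [hlam 1, hs.2]
    · rw [transition_renewal hlam hγ (1 - 1) (by linarith [hs.2]) _ hB]
      refine le_trans ?_ le_self_add
      rw [indicator_of_mem (by simp), Pi.one_apply, mul_one]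
      refine ENNReal.ofReal_le_ofReal (Real.exp_le_exp.2 ?_)
      simp only [sub_self]
      nlinarith [hlam 0, hs.1]
  refine lt_of_lt_of_le ?_ hle
  rw [setLIntegral_const]
  simpa using hkpos

/-- The chain does not feel the position, so the marginal is stationary for a two-state chain with
probabilities `q i` of being in 0 at time 1. As `q 1 > 0`, the mass of state 0 must be `q 1 / (1 - q
0 + q 1)`. -/
lemma map_snd_eq_of_isInvariant (hlam : ∀ i, 0 < lam i) (hγ : ∀ i, 0 < γ i)
    {μ ν : Measure (ℝ × Fin 2)} [IsProbabilityMeasure μ] [IsProbabilityMeasure ν]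
    (hμ : IsInvariant lam a γ μ) (hν : IsInvariant lam a γ ν) :
    μ.map Prod.snd = ν.map Prod.snd := by
  have hB : MeasurableSet ((univ : Set ℝ) ×ˢ ({0} : Set (Fin 2))) :=
    MeasurableSet.univ.prod (measurableSet_singleton _)
  set q : Fin 2 → ENNReal := fun i => transition lam a γ 1 (0, i) (univ ×ˢ {0}) with hq
  have hqx : ∀ z : ℝ × Fin 2, transition lam a γ 1 z (univ ×ˢ {0}) = q z.2 := by
    rintro ⟨x, i⟩
    simp only [hq]
    rw [transition_apply a γ i lam 1 x hB, transition_apply a γ i lam 1 0 hB]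
    congr 1
  have hqle : ∀ i, q i ≤ 1 := fun i => by
    have := isProbabilityMeasure_transition (a := a) (γ := γ) hlam 1 (0, i)
    exact prob_le_one
  have hq1 : 0 < (q 1).toReal := ENNReal.toReal_pos (transition_univ_prod_pos hlam hγ 0).ne'
    (ne_top_of_le_ne_top ENNReal.one_ne_top (hqle 1))
  have hq0 : (q 0).toReal ≤ 1 := by
    simpa using ENNReal.toReal_mono ENNReal.one_ne_top (hqle 0)
  have key : ∀ (ν : Measure (ℝ × Fin 2)) [IsProbabilityMeasure ν], IsInvariant lam a γ ν →
      (ν.map Prod.snd {0}).toReal = (q 1).toReal / (1 - (q 0).toReal + (q 1).toReal) ∧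
      (ν.map Prod.snd {0}).toReal + (ν.map Prod.snd {1}).toReal = 1 := by
    intro ν _ hν
    have : IsProbabilityMeasure (ν.map Prod.snd) :=
      Measure.isProbabilityMeasure_map measurable_snd.aemeasurable
    have h1 : ν.map Prod.snd {0} = q 0 * ν.map Prod.snd {0} + q 1 * ν.map Prod.snd {1} := by
      rw [← lintegral_snd]
      simp_rw [← hqx]
      rw [← hν 1 zero_le_one _ hB, Measure.map_apply measurable_snd (measurableSet_singleton _)]
      congr 1
      ext z; simp
    have h2 : (ν.map Prod.snd {0}).toReal + (ν.map Prod.snd {1}).toReal = 1 := by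
      have := lintegral_snd (ν := ν) (fun _ => 1)
      simp only [lintegral_one, measure_univ, one_mul] at this
      rw [← ENNReal.toReal_add (measure_ne_top _ _) (measure_ne_top _ _), ← this,
        ENNReal.toReal_one]
    have h3 := congrArg ENNReal.toReal h1
    rw [ENNReal.toReal_add (ENNReal.mul_ne_top (ne_top_of_le_ne_top ENNReal.one_ne_top (hqle 0))
      (measure_ne_top _ _)) (ENNReal.mul_ne_top (ne_top_of_le_ne_top ENNReal.one_ne_top (hqle 1))
      (measure_ne_top _ _)), ENNReal.toReal_mul, ENNReal.toReal_mul] at h3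
    refine ⟨?_, h2⟩
    rw [eq_div_iff (by linarith)]
    linear_combination h3 + (q 1).toReal * h2
  obtain ⟨m0, m1⟩ := key μ hμ
  obtain ⟨n0, n1⟩ := key ν hν
  have : IsProbabilityMeasure (μ.map Prod.snd) :=
    Measure.isProbabilityMeasure_map measurable_snd.aemeasurable
  have : IsProbabilityMeasure (ν.map Prod.snd) :=
    Measure.isProbabilityMeasure_map measurable_snd.aemeasurable
  refine Measure.ext_of_singleton fun j => ?_
  rw [← ENNReal.toReal_eq_toReal_iff' (measure_ne_top _ _) (measure_ne_top _ _)]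
  fin_cases j
  · exact m0.trans n0.symm
  · change (μ.map Prod.snd {1}).toReal = (ν.map Prod.snd {1}).toReal
    linarith

/-- Moving the starting position to 0 costs at most `L * |x| * exp (-(g * n))` pointwise.
Boundedness of `f` supplies the dominating constant, so `ν` needs no moments. -/
lemma tendsto_integral_sub (hlam : ∀ i, 0 < lam i) (hγ : ∀ i, 0 < γ i)
    (ν : Measure (ℝ × Fin 2)) [IsProbabilityMeasure ν] {f : ℝ × Fin 2 → ℂ} (hf : Measurable f)
    {M L : ℝ} (hM : ∀ z, ‖f z‖ ≤ M) (hL : 0 ≤ L)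
    (hfL : ∀ x y i, ‖f (x, i) - f (y, i)‖ ≤ L * |x - y|) :
    Filter.Tendsto (fun n : ℕ => ∫ z, ((∫ w, f w ∂(transition lam a γ n z))
      - ∫ w, f w ∂(transition lam a γ n (0, z.2))) ∂ν) Filter.atTop (nhds 0) := by
  obtain ⟨g, hg0, hg⟩ : ∃ g : ℝ, 0 < g ∧ ∀ i, g ≤ γ i :=
    ⟨min (γ 0) (γ 1), lt_min (hγ 0) (hγ 1), fun i => by fin_cases i <;> simp⟩
  have hPm : ∀ t, Measurable fun z => ∫ w, f w ∂(transition lam a γ t z) := fun t => by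
    have := isMarkovKernel_transitionKernel (a := a) (γ := γ) hlam t
    exact (hf.stronglyMeasurable.integral_kernel (κ := transitionKernel lam a γ hlam t)).measurable
  have hPb : ∀ t z, ‖∫ w, f w ∂(transition lam a γ t z)‖ ≤ M := fun t z => by
    have := isProbabilityMeasure_transition (a := a) (γ := γ) hlam t z
    exact (norm_integral_le_of_norm_le_const (Filter.Eventually.of_forall hM)).trans (by simp)
  rw [← integral_zero (ℝ × Fin 2) ℂ (μ := ν)]
  refine tendsto_integral_of_dominated_convergence (fun _ => M + M) (fun n => ?_)
    (integrable_const _) (fun n => Filter.Eventually.of_forall fun z => ?_)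
    (Filter.Eventually.of_forall fun z => ?_)
  · have h2 : Measurable fun z : ℝ × Fin 2 => ((0 : ℝ), z.2) := measurable_const.prodMk measurable_snd
    exact ((hPm n).sub ((hPm n).comp h2)).aestronglyMeasurable
  · exact (norm_sub_le _ _).trans (add_le_add (hPb _ _) (hPb _ _))
  · refine squeeze_zero_norm (a := fun n : ℕ => L * (|z.1 - 0| * Real.exp (-(g * n))))
      (fun n => norm_integral_transition_sub_le hlam n.cast_nonneg hg hf hM hL hfL z.1 0 z.2) ?_
    have h1 : Filter.Tendsto (fun n : ℕ => Real.exp (-(g * n))) Filter.atTop (nhds 0) :=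
      Real.tendsto_exp_neg_atTop_nhds_zero.comp
        (tendsto_natCast_atTop_atTop.const_mul_atTop hg0)
    simpa using (h1.const_mul |z.1 - 0|).const_mul L

/-- Up to an error tending to 0, the integral of `f` depends only on the marginal on states, which
`μ` and `ν` share. -/
lemma integral_eq_of_isInvariant (hlam : ∀ i, 0 < lam i) (hγ : ∀ i, 0 < γ i)
    {μ ν : Measure (ℝ × Fin 2)} [IsProbabilityMeasure μ] [IsProbabilityMeasure ν]
    (hμ : IsInvariant lam a γ μ) (hν : IsInvariant lam a γ ν)
    {f : ℝ × Fin 2 → ℂ} (hf : Measurable f) {M L : ℝ} (hM : ∀ z, ‖f z‖ ≤ M) (hL : 0 ≤ L)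
    (hfL : ∀ x y i, ‖f (x, i) - f (y, i)‖ ≤ L * |x - y|) :
    ∫ z, f z ∂μ = ∫ z, f z ∂ν := by
  have hPm : ∀ t, Measurable fun z => ∫ w, f w ∂(transition lam a γ t z) := fun t => by
    have := isMarkovKernel_transitionKernel (a := a) (γ := γ) hlam t
    exact (hf.stronglyMeasurable.integral_kernel (κ := transitionKernel lam a γ hlam t)).measurable
  have hPb : ∀ t z, ‖∫ w, f w ∂(transition lam a γ t z)‖ ≤ M := fun t z => by
    have := isProbabilityMeasure_transition (a := a) (γ := γ) hlam t z
    exact (norm_integral_le_of_norm_le_const (Filter.Eventually.of_forall hM)).trans (by simp)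
  have h2 : Measurable fun z : ℝ × Fin 2 => ((0 : ℝ), z.2) := measurable_const.prodMk measurable_snd
  have key : ∀ (ν : Measure (ℝ × Fin 2)) [IsProbabilityMeasure ν], IsInvariant lam a γ ν → ∀ n : ℕ,
      ∫ z, f z ∂ν - ∫ z, ((∫ w, f w ∂(transition lam a γ n z))
          - ∫ w, f w ∂(transition lam a γ n (0, z.2))) ∂ν
        = ∫ j, (∫ w, f w ∂(transition lam a γ n (0, j))) ∂(ν.map Prod.snd) := by
    intro ν _ hν n
    have hi1 : Integrable (fun z => ∫ w, f w ∂(transition lam a γ n z)) ν :=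
      Integrable.of_bound (hPm n).aestronglyMeasurable M (Filter.Eventually.of_forall (hPb n))
    have hi2 : Integrable (fun z : ℝ × Fin 2 => ∫ w, f w ∂(transition lam a γ n (0, z.2))) ν :=
      Integrable.of_bound ((hPm n).comp h2).aestronglyMeasurable M
        (Filter.Eventually.of_forall fun z => hPb n _)
    rw [integral_sub hi1 hi2, hν.integral_eq hlam (Nat.cast_nonneg n)
      (Integrable.of_bound hf.aestronglyMeasurable M (Filter.Eventually.of_forall hM)),
      sub_sub_cancel, integral_map measurable_snd.aemeasurable
      (measurable_of_finite _).aestronglyMeasurable]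
  have t1 := (tendsto_const_nhds (x := ∫ z, f z ∂μ)).sub
    (tendsto_integral_sub (a := a) hlam hγ μ hf hM hL hfL)
  have t2 := (tendsto_const_nhds (x := ∫ z, f z ∂ν)).sub
    (tendsto_integral_sub (a := a) hlam hγ ν hf hM hL hfL)
  simp_rw [key μ hμ, map_snd_eq_of_isInvariant hlam hγ hμ hν, ← key ν hν] at t1
  simpa using tendsto_nhds_unique t1 t2

theorem eq_of_isInvariant (hlam : ∀ i, 0 < lam i) (hγ : ∀ i, 0 < γ i)
    {μ ν : Measure (ℝ × Fin 2)} [IsProbabilityMeasure μ] [IsProbabilityMeasure ν]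
    (hμ : IsInvariant lam a γ μ) (hν : IsInvariant lam a γ ν) : μ = ν := by
  have hS : ∀ j : Fin 2, MeasurableSet (Prod.snd ⁻¹' {j} : Set (ℝ × Fin 2)) := fun j =>
    measurable_snd (measurableSet_singleton j)
  have hslice : ∀ j : Fin 2, (μ.restrict (Prod.snd ⁻¹' {j})).map Prod.fst
      = (ν.restrict (Prod.snd ⁻¹' {j})).map Prod.fst := by
    intro j
    -- The test function `exp (i u x)` on slice `j`, extended by 0, is bounded by 1 and
    -- `|u|`-Lipschitz in `x` within each state.
    refine Measure.ext_of_charFun (funext fun u => ?_)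
    have hm : Measurable fun x : ℝ => Complex.exp (u * x * Complex.I) := by fun_prop
    rw [charFun_apply_real, charFun_apply_real,
      integral_map measurable_fst.aemeasurable hm.aestronglyMeasurable,
      integral_map measurable_fst.aemeasurable hm.aestronglyMeasurable,
      ← integral_indicator (hS j), ← integral_indicator (hS j)]
    have hnorm : ∀ r : ℝ, ‖Complex.exp (r * Complex.I)‖ = 1 := Complex.norm_exp_ofReal_mul_I
    refine integral_eq_of_isInvariant hlam hγ hμ hν ((hm.comp measurable_fst).indicator (hS j))
      (M := 1) (L := |u|) (fun z => ?_) (abs_nonneg u) (fun x y i => ?_)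
    · refine (norm_indicator_le_norm_self _ _).trans ?_
      rw [← Complex.ofReal_mul, hnorm]
    · by_cases hi : i = j
      · rw [indicator_of_mem (by simpa using hi), indicator_of_mem (by simpa using hi)]
        have h1 : Complex.exp (u * x * Complex.I) - Complex.exp (u * y * Complex.I)
            = Complex.exp (((u * y : ℝ) : ℂ) * Complex.I)
              * (Complex.exp (Complex.I * ((u * (x - y) : ℝ) : ℂ)) - 1) := by
          rw [mul_sub, ← Complex.exp_add, mul_one]
          congr 2 <;> push_cast <;> ring_nf
        simp only
        rw [h1, norm_mul, hnorm, one_mul]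
        refine (Real.norm_exp_I_mul_ofReal_sub_one_le).trans ?_
        rw [Real.norm_eq_abs, abs_mul]
      · rw [indicator_of_notMem (by simpa using hi), indicator_of_notMem (by simpa using hi)]
        simp only [sub_self, norm_zero]
        positivity
  ext B hB
  have hsplit : ∀ ν : Measure (ℝ × Fin 2), ν B
      = ∑ j, (ν.restrict (Prod.snd ⁻¹' {j})).map Prod.fst ((fun x => (x, j)) ⁻¹' B) := by
    intro ν
    have h1 : ∀ j : Fin 2, (ν.restrict (Prod.snd ⁻¹' {j})).map Prod.fst ((fun x => (x, j)) ⁻¹' B)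
        = ν (B ∩ Prod.snd ⁻¹' {j}) := fun j => by
      have hBj : MeasurableSet ((fun x : ℝ => (x, j)) ⁻¹' B) := measurable_prodMk_right hB
      rw [Measure.map_apply measurable_fst hBj, Measure.restrict_apply (measurable_fst hBj)]
      congr 1
      ext ⟨x, i⟩
      simp only [mem_inter_iff, mem_preimage, mem_singleton_iff]
      constructor
      · rintro ⟨h, rfl⟩; exact ⟨h, rfl⟩
      · rintro ⟨h, rfl⟩; exact ⟨h, rfl⟩
    simp_rw [h1]
    rw [Fin.sum_univ_two, ← measure_union _ (hB.inter (hS 1))]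
    · congr 1
      ext ⟨x, i⟩
      fin_cases i <;> simp
    · refine Set.disjoint_left.2 fun z hz hz' => ?_
      have h0 := hz.2
      have h1 := hz'.2
      simp only [mem_preimage, mem_singleton_iff] at h0 h1
      rw [h0] at h1
      exact absurd h1 (by decide)
  rw [hsplit μ, hsplit ν]
  simp_rw [hslice]

end Uniqueness

/-! ### Normalising constants and explicit densities. -/

section Constants

lemma lintegral_profile {α β : ℝ} (hα : 0 < α) (hβ : 0 < β) :
    ∫⁻ u, ENNReal.ofReal (profile α β u) = ENNReal.ofReal (beta α (β + 1)) := by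
  have hb : 0 < beta α (β + 1) := beta_pos hα (by linarith)
  have h : ∀ u, ENNReal.ofReal (profile α β u)
      = ENNReal.ofReal (beta α (β + 1)) * betaPDF α (β + 1) u := fun u => by
    rw [betaPDF_eq, ← ENNReal.ofReal_mul hb.le]
    congr 1
    split_ifs with hu
    · rw [profile_of_mem hu, add_sub_cancel_right]
      field_simp
    · rw [mul_zero]
      exact indicator_of_notMem (s := Ioo (0 : ℝ) 1) hu _
  simp_rw [h]
  rw [lintegral_const_mul' _ _ ENNReal.ofReal_ne_top,
    lintegral_betaPDF_eq_one hα (by linarith), mul_one]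

lemma beta_comm (α β : ℝ) : beta α β = beta β α := by
  rw [beta, beta, mul_comm, add_comm]

lemma profile_div {α β v w L : ℝ} (hv : 0 < v) (hw : 0 < w) (hL : v + w = L) :
    profile α β (v / L) = v ^ (α - 1) * w ^ β / L ^ (α + β - 1) := by
  have hL0 : 0 < L := by linarith
  have h1 : 1 - v / L = w / L := by field_simp; linarith
  rw [profile_of_mem ⟨by positivity, by rw [div_lt_one hL0]; linarith⟩, h1,
    Real.div_rpow hv.le hL0.le, Real.div_rpow hw.le hL0.le, div_mul_div_comm,
    ← Real.rpow_add hL0]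
  congr 2; ring

variable {γ ρ α : Fin 2 → ℝ}

/-- The power of `ρ 1 - ρ 0` in the constant undoes the rescaling to the unit interval. -/
lemma density_zero_eq {c : ℝ} (hρ01 : ρ 0 < ρ 1) :
    density (c * (ρ 1 - ρ 0) ^ (α 0 + α 1 - 1)) γ ρ α 0 = (Ioo (ρ 0) (ρ 1)).indicator
      (fun x => c * (γ 0)⁻¹ * (x - ρ 0) ^ (α 0 - 1) * (ρ 1 - x) ^ α 1) := by
  have hL : 0 < ρ 1 - ρ 0 := sub_pos.2 hρ01
  funext x
  rw [density, sub_zero]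
  by_cases hx : x ∈ Ioo (ρ 0) (ρ 1)
  · rw [indicator_of_mem hx, profile_div (sub_pos.2 hx.1) (sub_pos.2 hx.2) (by ring)]
    have := (Real.rpow_pos_of_pos hL (α 0 + α 1 - 1)).ne'
    field_simp
  · rw [indicator_of_notMem hx]
    rcases le_or_gt x (ρ 0) with h | h
    · rw [profile_of_nonpos (div_nonpos_of_nonpos_of_nonneg (by linarith) hL.le), mul_zero]
    · have : ρ 1 ≤ x := not_lt.1 fun h' => hx ⟨h, h'⟩
      rw [profile_of_one_le ((one_le_div hL).2 (by linarith)), mul_zero]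

lemma density_one_eq {c : ℝ} (hρ01 : ρ 0 < ρ 1) :
    density (c * (ρ 1 - ρ 0) ^ (α 0 + α 1 - 1)) γ ρ α 1 = (Ioo (ρ 0) (ρ 1)).indicator
      (fun x => c * (γ 1)⁻¹ * (x - ρ 0) ^ α 0 * (ρ 1 - x) ^ (α 1 - 1)) := by
  have hL : 0 < ρ 1 - ρ 0 := sub_pos.2 hρ01
  funext x
  have hdiv : (x - ρ 1) / (ρ 0 - ρ 1) = (ρ 1 - x) / (ρ 1 - ρ 0) := by
    rw [← neg_sub, ← neg_sub (ρ 1) (ρ 0), neg_div_neg_eq]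
  rw [density, sub_self, hdiv]
  by_cases hx : x ∈ Ioo (ρ 0) (ρ 1)
  · rw [indicator_of_mem hx, profile_div (sub_pos.2 hx.2) (sub_pos.2 hx.1) (by ring),
      add_comm (α 1)]
    have := (Real.rpow_pos_of_pos hL (α 0 + α 1 - 1)).ne'
    field_simp
  · rw [indicator_of_notMem hx]
    rcases le_or_gt x (ρ 0) with h | h
    · rw [profile_of_one_le ((one_le_div hL).2 (by linarith)), mul_zero]
    · have : ρ 1 ≤ x := not_lt.1 fun h' => hx ⟨h, h'⟩
      rw [profile_of_nonpos (div_nonpos_of_nonpos_of_nonneg (by linarith) hL.le), mul_zero]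

lemma density_of_notMem (C : ℝ) (hρ01 : ρ 0 < ρ 1) (i : Fin 2) {x : ℝ}
    (hx : x ∉ Ioo (ρ 0) (ρ 1)) : density C γ ρ α i x = 0 := by
  have hL := Real.rpow_pos_of_pos (sub_pos.2 hρ01) (α 0 + α 1 - 1)
  have hC : C = C / (ρ 1 - ρ 0) ^ (α 0 + α 1 - 1) * (ρ 1 - ρ 0) ^ (α 0 + α 1 - 1) := by
    field_simp
  rw [hC]
  fin_cases i
  · exact (congrFun (density_zero_eq hρ01) x).trans (indicator_of_notMem hx _)
  · exact (congrFun (density_one_eq hρ01) x).trans (indicator_of_notMem hx _)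

lemma lintegral_density (hγ : ∀ i, 0 < γ i) (hα : ∀ i, 0 < α i) {C : ℝ} (hC : 0 ≤ C)
    (hρ01 : ρ 0 < ρ 1) (i : Fin 2) :
    ∫⁻ x, ENNReal.ofReal (density C γ ρ α i x)
      = ENNReal.ofReal (C / γ i * (ρ 1 - ρ 0) * beta (α i) (α (1 - i) + 1)) := by
  have hL : 0 < ρ 1 - ρ 0 := sub_pos.2 hρ01
  have hd : |ρ (1 - i) - ρ i| = ρ 1 - ρ 0 := by
    fin_cases i
    · simpa using hL.le
    · change |ρ 0 - ρ 1| = _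
      rw [abs_sub_comm, abs_of_pos hL]
  have hne : ρ (1 - i) - ρ i ≠ 0 := abs_pos.1 (hd ▸ hL)
  have hCi : 0 ≤ C / γ i := div_nonneg hC (hγ i).le
  have h := lintegral_comp_affine (fun u => ENNReal.ofReal (profile (α i) (α (1 - i)) u))
    (inv_ne_zero hne) (ρ i) 0
  rw [lintegral_profile (hα i) (hα (1 - i)), abs_inv, hd] at h
  rw [ENNReal.ofReal_mul (mul_nonneg hCi hL.le), ← h, ← lintegral_const_mul' _ _ ENNReal.ofReal_ne_top]
  refine lintegral_congr fun x => ?_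
  rw [← ENNReal.ofReal_mul (inv_pos.2 hL).le, ← ENNReal.ofReal_mul (mul_nonneg hCi hL.le), density,
    zero_add, div_eq_mul_inv (x - ρ i)]
  congr 1
  field_simp

end Constants

lemma beta_one_two : beta 1 (1 + 1) = 1 / 2 := by
  have h3 : Real.Gamma (1 + (1 + 1)) = 2 := by
    have := Real.Gamma_nat_eq_factorial 2
    norm_num at this ⊢
  rw [beta, h3, one_add_one_eq_two, Real.Gamma_one, Real.Gamma_two]
  norm_num

end KacOU

/-! ### Assembly of the theorem. -/

open KacOU in
theorem mainTheorem3 (lam a γ ρ α : Fin 2 → ℝ)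
    (hlam : ∀ i, 0 < lam i) (hγ : ∀ i, 0 < γ i)
    (hρ : ∀ i, ρ i = a i / γ i) (hα : ∀ i, α i = lam i / γ i)
    (hρ01 : ρ 0 < ρ 1) :
    ∃ (c : ℝ) (p : Fin 2 → ℝ → ℝ) (μ : Measure (ℝ × Fin 2)),
      0 < c ∧
      c⁻¹ = (ρ 1 - ρ 0) ^ (α 0 + α 1)
        * ((γ 0)⁻¹ * beta (α 0) (α 1 + 1) + (γ 1)⁻¹ * beta (α 0 + 1) (α 1)) ∧
      p 0 = (Ioo (ρ 0) (ρ 1)).indicator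
        (fun x => c * (γ 0)⁻¹ * (x - ρ 0) ^ (α 0 - 1) * (ρ 1 - x) ^ α 1) ∧
      p 1 = (Ioo (ρ 0) (ρ 1)).indicator
        (fun x => c * (γ 1)⁻¹ * (x - ρ 0) ^ α 0 * (ρ 1 - x) ^ (α 1 - 1)) ∧
      (∀ i, Integrable (p i)) ∧
      (∫ x in (ρ 0)..(ρ 1), (p 0 x + p 1 x)) = 1 ∧
      IsProbabilityMeasure μ ∧
      KacOU.IsInvariant lam a γ μ ∧
      (∀ ν : Measure (ℝ × Fin 2), IsProbabilityMeasure ν →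
        KacOU.IsInvariant lam a γ ν → ν = μ) ∧
      μ ((Icc (ρ 0) (ρ 1))ᶜ ×ˢ univ) = 0 ∧
      KacOU.HasDensities μ p ∧
      (∀ g : ℝ, (∀ i, γ i = g) → (∀ i, lam i = g) →
        c⁻¹ = (ρ 1 - ρ 0) ^ 2 * g⁻¹ ∧
        (∀ x ∈ Ioo (ρ 0) (ρ 1),
          p 0 x = (ρ 1 - x) / (ρ 1 - ρ 0) ^ 2 ∧ p 1 x = (x - ρ 0) / (ρ 1 - ρ 0) ^ 2) ∧
        μ.map Prod.fst = cond volume (Icc (ρ 0) (ρ 1))) := by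
  have hαpos : ∀ j, 0 < α j := fun j => by rw [hα]; exact div_pos (hlam j) (hγ j)
  have hL : 0 < ρ 1 - ρ 0 := sub_pos.2 hρ01
  set K : ℝ := (ρ 1 - ρ 0) ^ (α 0 + α 1)
    * ((γ 0)⁻¹ * beta (α 0) (α 1 + 1) + (γ 1)⁻¹ * beta (α 0 + 1) (α 1)) with hK
  have hb0 : 0 < beta (α 0) (α 1 + 1) := beta_pos (hαpos 0) (by linarith [hαpos 1])
  have hb1 : 0 < beta (α 0 + 1) (α 1) := beta_pos (by linarith [hαpos 0]) (hαpos 1)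
  have hK0 : 0 < K := mul_pos (Real.rpow_pos_of_pos hL _)
    (add_pos (mul_pos (inv_pos.2 (hγ 0)) hb0) (mul_pos (inv_pos.2 (hγ 1)) hb1))
  set c : ℝ := K⁻¹ with hc
  have hc0 : 0 < c := inv_pos.2 hK0
  set C : ℝ := c * (ρ 1 - ρ 0) ^ (α 0 + α 1 - 1) with hC
  have hC0 : 0 ≤ C := mul_nonneg hc0.le (Real.rpow_pos_of_pos hL _).le
  set p : Fin 2 → ℝ → ℝ := density C γ ρ α with hp
  have hp0 : p 0 = (Ioo (ρ 0) (ρ 1)).indicator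
      (fun x => c * (γ 0)⁻¹ * (x - ρ 0) ^ (α 0 - 1) * (ρ 1 - x) ^ α 1) := density_zero_eq hρ01
  have hp1 : p 1 = (Ioo (ρ 0) (ρ 1)).indicator
      (fun x => c * (γ 1)⁻¹ * (x - ρ 0) ^ α 0 * (ρ 1 - x) ^ (α 1 - 1)) := density_one_eq hρ01
  have hpm : ∀ i, Measurable (p i) := measurable_density C γ ρ α
  have hpn : ∀ i x, 0 ≤ p i x := density_nonneg hγ hC0
  have hpout : ∀ i x, x ∉ Ioo (ρ 0) (ρ 1) → p i x = 0 := fun i x hx => density_of_notMem C hρ01 i hx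
  set m : Fin 2 → ℝ := fun i => C / γ i * (ρ 1 - ρ 0) * beta (α i) (α (1 - i) + 1) with hm
  have hm0 : ∀ i, 0 ≤ m i := fun i => mul_nonneg
    (mul_nonneg (div_nonneg hC0 (hγ i).le) hL.le)
    (beta_pos (hαpos i) (by linarith [hαpos (1 - i)])).le
  have hmass : ∀ i, ∫⁻ x, ENNReal.ofReal (p i x) = ENNReal.ofReal (m i) := fun i =>
    lintegral_density hγ hαpos hC0 hρ01 i
  have hmsum : m 0 + m 1 = 1 := by
    have h1 : C * (ρ 1 - ρ 0) = c * (ρ 1 - ρ 0) ^ (α 0 + α 1) := by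
      rw [hC, mul_assoc, Real.rpow_sub_one hL.ne']; field_simp
    have h2 : m 0 + m 1 = c * K := by
      simp only [hm, sub_zero, sub_self]
      rw [hK, beta_comm (α 1)]
      linear_combination ((γ 0)⁻¹ * beta (α 0) (α 1 + 1) + (γ 1)⁻¹ * beta (α 0 + 1) (α 1)) * h1
    rw [h2, hc, inv_mul_cancel₀ hK0.ne']
  have hint : ∀ i, Integrable (p i) := fun i => by
    refine ⟨(hpm i).aestronglyMeasurable, ?_⟩
    rw [hasFiniteIntegral_iff_ofReal (Filter.Eventually.of_forall (hpn i)), hmass]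
    exact ENNReal.ofReal_lt_top
  have hval : ∀ i, ∫ x, p i x = m i := fun i => by
    rw [integral_eq_lintegral_of_nonneg_ae (Filter.Eventually.of_forall (hpn i))
      (hpm i).aestronglyMeasurable, hmass, ENNReal.toReal_ofReal (hm0 i)]
  set D : Fin 2 → ℝ → ENNReal := fun i x => ENNReal.ofReal (p i x) with hDdef
  have hD : ∀ i, Measurable (D i) := fun i => (hpm i).ennreal_ofReal
  have hinv : IsInvariant lam a γ (mixture D) :=
    isInvariant_mixture_density hlam hγ hρ hα hρ01 hC0 fun i => by
      rw [hmass]; exact ENNReal.ofReal_ne_top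
  have hprob : IsProbabilityMeasure (mixture D) := ⟨by
    rw [mixture_apply hD MeasurableSet.univ]
    simp only [indicator_univ, Pi.one_apply, mul_one, Fin.sum_univ_two, hDdef, hmass]
    rw [← ENNReal.ofReal_add (hm0 0) (hm0 1), hmsum, ENNReal.ofReal_one]⟩
  have hprod : ∀ B : Set ℝ, MeasurableSet B → ∀ S : Set (Fin 2), mixture D (B ×ˢ S)
      = ∑ i, S.indicator (fun i => ∫⁻ x in B, D i x) i := by
    intro B hB S
    rw [mixture_apply hD (hB.prod S.toFinite.measurableSet)]
    refine Finset.sum_congr rfl fun i _ => ?_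
    by_cases hi : i ∈ S
    · rw [indicator_of_mem hi, ← lintegral_indicator hB]
      refine lintegral_congr fun x => ?_
      by_cases hx : x ∈ B
      · rw [indicator_of_mem hx, indicator_of_mem (mk_mem_prod hx hi), Pi.one_apply, mul_one]
      · rw [indicator_of_notMem hx, indicator_of_notMem (s := B ×ˢ S) fun h => hx h.1, mul_zero]
    · rw [indicator_of_notMem hi]
      refine lintegral_eq_zero_of_ae_eq_zero (Filter.Eventually.of_forall fun x => ?_)
      simp only
      rw [indicator_of_notMem (s := B ×ˢ S) fun h => hi h.2, mul_zero]
      rfl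
  refine ⟨c, p, mixture D, hc0, inv_inv K, hp0, hp1, hint, ?_, hprob, hinv, ?_, ?_, ?_, ?_⟩
  · rw [intervalIntegral.integral_of_le hρ01.le,
      setIntegral_eq_integral_of_forall_compl_eq_zero fun x hx => ?_,
      integral_add (hint 0) (hint 1), hval, hval, hmsum]
    have hx' : x ∉ Ioo (ρ 0) (ρ 1) := fun h => hx ⟨h.1, h.2.le⟩
    rw [hpout 0 x hx', hpout 1 x hx', add_zero]
  · intro ν hν hνinv
    exact eq_of_isInvariant hlam hγ hνinv hinv
  · rw [hprod _ measurableSet_Icc.compl]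
    refine Finset.sum_eq_zero fun i _ => ?_
    rw [indicator_of_mem (mem_univ i), setLIntegral_congr_fun measurableSet_Icc.compl
      (g := fun _ => 0) fun x hx => ?_, lintegral_zero]
    simp only [hDdef]
    rw [hpout i x fun h => hx ⟨h.1.le, h.2.le⟩, ENNReal.ofReal_zero]
  · intro i
    refine ⟨hpm i, hpn i, fun B hB => ?_⟩
    rw [hprod B hB, Finset.sum_eq_single i, indicator_of_mem (mem_singleton i)]
    · intro j _ hj
      exact indicator_of_notMem (s := {i}) (a := j) (by simpa using fun h => hj h) _
    · intro hi
      exact absurd (Finset.mem_univ i) hi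
  · intro g hγg hlg
    have hg : 0 < g := hγg 0 ▸ hγ 0
    have hα1 : ∀ i, α i = 1 := fun i => by rw [hα, hγg, hlg, div_self hg.ne']
    have hcinv : c⁻¹ = (ρ 1 - ρ 0) ^ 2 * g⁻¹ := by
      rw [hc, inv_inv, hK, hα1, hα1, hγg, hγg, beta_comm (1 + 1), beta_one_two, one_add_one_eq_two,
        Real.rpow_two]
      ring
    have hcg : c * g⁻¹ = 1 / (ρ 1 - ρ 0) ^ 2 := by
      rw [← inv_inv c, hcinv]; field_simp
    have hlin : ∀ x ∈ Ioo (ρ 0) (ρ 1),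
        p 0 x = (ρ 1 - x) / (ρ 1 - ρ 0) ^ 2 ∧ p 1 x = (x - ρ 0) / (ρ 1 - ρ 0) ^ 2 := by
      intro x hx
      rw [hp0, hp1, indicator_of_mem hx, indicator_of_mem hx]
      simp only [hα1, hγg, hcg, sub_self, Real.rpow_zero, Real.rpow_one]
      constructor <;> ring
    refine ⟨hcinv, hlin, ?_⟩
    ext B hB
    rw [Measure.map_apply measurable_fst hB, ← prod_univ, hprod B hB, cond_apply measurableSet_Icc,
      Fin.sum_univ_two, indicator_of_mem (mem_univ _), indicator_of_mem (mem_univ _),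
      ← lintegral_add_left (hD 0), Real.volume_Icc,
      ← Measure.restrict_apply' hB, ← lintegral_indicator_const measurableSet_Icc]
    -- The densities vanish at the endpoints while the uniform law is taken on the closed interval,
    -- so equality is only almost everywhere.
    refine lintegral_congr_ae (ae_restrict_of_ae ?_)
    have h0 : ∀ᵐ x : ℝ, x ≠ ρ 0 := by simp [ae_iff, measure_singleton]
    have h1 : ∀ᵐ x : ℝ, x ≠ ρ 1 := by simp [ae_iff, measure_singleton]
    filter_upwards [h0, h1] with x hx0 hx1
    simp only [hDdef]
    rw [← ENNReal.ofReal_add (hpn 0 x) (hpn 1 x)]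
    by_cases hx : x ∈ Ioo (ρ 0) (ρ 1)
    · rw [indicator_of_mem (Ioo_subset_Icc_self hx), (hlin x hx).1, (hlin x hx).2,
        ← ENNReal.ofReal_inv_of_pos hL]
      congr 1
      field_simp
      ring
    · rw [hpout 0 x hx, hpout 1 x hx, add_zero, ENNReal.ofReal_zero, indicator_of_notMem]
      exact fun h => hx ⟨lt_of_le_of_ne h.1 hx0.symm, lt_of_le_of_ne h.2 hx1⟩
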